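/- Let $p,q,k\ge 1$ be integers, and let $\phi_1,\phi_2,\dots:\mathbb R\to[-1,1]$ be (measurable) basis functions. Let $\mathcal F_{2k+1}$ be the set of binary trees with at most $2k+1$ nodes in which every non-leaf node has two children and carries the label $+$ or $*$, and every leaf carries a label $\phi_i(x_j)$ with $1\le i\le q$, $1\le j\le p$. For $f\in\mathcal F_{2k+1}$ let $\mathcal W(f)$ be the set of functions $g:\mathbb R^p\to\mathbb R$ obtained by multiplying the leaves of $f$ by real weights $w$ with $\|w\|_1\le 1$ (one weight for each leaf) and evaluating the tree. Let $\mathcal Y\subseteq\mathbb R$, let $\mathcal Z=\mathbb R^p\times\mathcal Y$, and let $d:\mathcal Y\times\mathbb R\to[0,1]$ be a (measurable) loss such that $d(y,\cdot)$ is 1-Lipschitz for every $y\in\mathcal Y$. Put $$\mathcal H_{2k+1}=\bigcup_{f\in\mathcal F_{2k+1}}\{(x,y)\mapsto d(y,g(x)) : g\in\mathcal W(f)\}.$$ Let $D$ be any probability distribution on $\mathcal Z$, let $S=(z_1,\dots,z_n)$ be an i.i.d. sample from $D$, and write $\mathbb E_D[h]=\mathbb E_{z\sim D}[h(z)]$ and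 $\widehat{\mathbb E}_S[h]=\frac1n\sum_{i=1}^n h(z_i)$. Fix $\delta,\varepsilon\in(0,1)$. If $$n\ \ge\ \frac{3(k+1)(\log(pq)+8)+3\log(8k\cdot k!)+6\log(2/\delta)}{2\varepsilon^2},$$ then minimizers $\hat h\in\arg\min_{h\in\mathcal H_{2k+1}}\widehat{\mathbb E}_S[h]$ (for every $S$) and $\bar h\in\arg\min_{h\in\mathcal H_{2k+1}}\mathbb E_D[h]$ exist, and with probability at least $1-\delta$ over the choice of $S$, all such minimizers satisfy $$\mathbb E_D[\hat h]-\mathbb E_D[\bar h]\le\varepsilon .$$ Moreover, for fixed $\delta,\varepsilon$ the required number of samples is $O(k\log(pq)+\log k!)$: there is a constant $C$ depending only on $\delta$ and $\varepsilon$ such that, for all integers $k\ge1$ and $p,q\ge 1$ with $pq\ge 2$, the right-hand side of the displayed bound on $n$ is at most $C\,(k\log(pq)+\log k!)$. -/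

import Mathlib

open MeasureTheory

namespace CompTree

/-- Labeled binary trees over `p` covariates and `q` basis functions: a leaf carries the label
`φ_i(x_j)`, and an inner node carries the label `+` or `*`. -/
inductive LabeledTree (p q : ℕ) : Type
  | leaf (i : Fin q) (j : Fin p) : LabeledTree p q
  | add (l r : LabeledTree p q) : LabeledTree p q
  | mul (l r : LabeledTree p q) : LabeledTree p q

namespace LabeledTree

variable {p q : ℕ}

/-- The number of nodes, inner nodes and leaves together. -/
def numNodes : LabeledTree p q → ℕ
  | leaf _ _ => 1
  | add l r => l.numNodes + r.numNodes + 1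
  | mul l r => l.numNodes + r.numNodes + 1

/-- The number of leaves. -/
def numLeaves : LabeledTree p q → ℕ
  | leaf _ _ => 1
  | add l r => l.numLeaves + r.numLeaves
  | mul l r => l.numLeaves + r.numLeaves

/-- The value at `x` of the tree whose leaves, read from left to right, carry the weights `w`:
a leaf contributes `w φ_i(x_j)`, inner nodes add or multiply the values of their subtrees. -/
def eval (φ : ℕ → ℝ → ℝ) (x : Fin p → ℝ) : (f : LabeledTree p q) → (Fin f.numLeaves → ℝ) → ℝ
  | leaf i j, w => w ⟨0, Nat.one_pos⟩ * φ i (x j)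
  | add l r, w =>
      eval φ x l (fun a => w (Fin.castAdd r.numLeaves a)) +
        eval φ x r (fun a => w (Fin.natAdd l.numLeaves a))
  | mul l r, w =>
      eval φ x l (fun a => w (Fin.castAdd r.numLeaves a)) *
        eval φ x r (fun a => w (Fin.natAdd l.numLeaves a))

end LabeledTree

/-- `𝓕_{2k+1}`: the labeled binary trees with no more than `2k+1` nodes. -/
def trees (p q k : ℕ) : Set (LabeledTree p q) :=
  {f | f.numNodes ≤ 2 * k + 1}

/-- `𝓦(f)`: the functions given by the tree `f` with leaf weights `w`, `‖w‖₁ ≤ 1`. -/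
def weighted {p q : ℕ} (φ : ℕ → ℝ → ℝ) (f : LabeledTree p q) : Set ((Fin p → ℝ) → ℝ) :=
  {g | ∃ w : Fin f.numLeaves → ℝ, ∑ a, |w a| ≤ 1 ∧ g = fun x => f.eval φ x w}

/-- `𝓗(f)`: the functions `(x, y) ↦ d(y, g(x))` with `g ∈ 𝓦(f)`. -/
def lossClass {p q : ℕ} {Y : Set ℝ} (φ : ℕ → ℝ → ℝ) (d : Y → ℝ → ℝ) (f : LabeledTree p q) :
    Set ((Fin p → ℝ) × Y → ℝ) :=
  {h | ∃ g ∈ weighted φ f, h = fun z => d z.2 (g z.1)}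

/-- `𝓗_{2k+1}`: the union of the `𝓗(f)` over the trees with no more than `2k+1` nodes. -/
def hypotheses (p q k : ℕ) {Y : Set ℝ} (φ : ℕ → ℝ → ℝ) (d : Y → ℝ → ℝ) :
    Set ((Fin p → ℝ) × Y → ℝ) :=
  ⋃ f ∈ trees p q k, lossClass φ d f

/-- The true risk `𝔼_D[h]`. -/
noncomputable def trueRisk {Z : Type*} [MeasurableSpace Z] (D : Measure Z) (h : Z → ℝ) : ℝ :=
  ∫ z, h z ∂D

/-- The empirical risk `(1/n) ∑ h(z_i)` of `h` on the dataset `S = (z_1, …, z_n)`. -/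
noncomputable def empiricalRisk {Z : Type*} {n : ℕ} (S : Fin n → Z) (h : Z → ℝ) : ℝ :=
  (1 / (n : ℝ)) * ∑ i, h (S i)

/-- `h` is a minimizer of `R` over the class `H`. -/
def IsArgmin {α : Type*} (H : Set α) (R : α → ℝ) (h : α) : Prop :=
  h ∈ H ∧ ∀ h' ∈ H, R h ≤ R h'

/-- `[3(k+1)(log pq + 8) + 3 log(8k·k!) + 6 log(2/δ)] / (2ε²)`. -/
noncomputable def sampleThreshold (k p q : ℕ) (δ ε : ℝ) : ℝ :=
  (3 * ((k : ℝ) + 1) * (Real.log ((p : ℝ) * q) + 8)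
      + 3 * Real.log (8 * (k : ℝ) * (k.factorial : ℝ)) + 6 * Real.log (2 / δ)) / (2 * ε ^ 2)

end CompTree

/-! Empirical risk minimization needs two one-sided deviations: for every hypothesis, the true risk
exceeds the empirical risk by little; for one fixed population minimizer, the empirical risk exceeds
the true risk by little. The second is Hoeffding for a single function and costs `δ / 2`. The first
is proved tree by tree and combined by a union bound, which costs the other `δ / 2`.

For a tree with `m` leaves, McDiarmid reduces the supremum over weights to its mean. Symmetrization
and contraction replace the loss by the tree function `g` itself (`integral_iSup_sum_sub_le`).
Distributing products over sums writes `g` as an absolutely convex combination of monomials in the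
basis functions: since `‖w‖₁ ≤ 1`, multiplying subtrees does not raise the `ℓ₁` norm of the
coefficients above `‖w‖₁` (`LabeledTree.exists_hull`). The number `N` of monomials satisfies `N ^ 3
≤ 3 ^ m`, so the largest of `N` Rademacher sums has mean at most `√(n m)`
(`exists_signAvg_envelope`, `card_le_or_log_le`), and the mean deviation is at most `2 √(n m)` with
`m ≤ k + 1`.

There are at most `∑ catalan j * 2 ^ j * (pq) ^ (k + 1)` trees (sum over `j ≤ k`), strictly fewer
than `8k · k! · (pq) ^ (k + 1)`; the logarithm of this is what the threshold contains. Minimizers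
exist because trees are finitely many, weights range over a compact ball, and both risks are
continuous in the weights. -/

namespace CompTree

/-! ### McDiarmid's inequality by integrating out one coordinate at a time. -/

section Concentration

variable {Z : Type*} [MeasurableSpace Z]

theorem integrable_of_abs_le {Ω : Type*} [MeasurableSpace Ω] {μ : Measure Ω} [IsFiniteMeasure μ]
    {F : Ω → ℝ} {K : ℝ} (hm : Measurable F) (hb : ∀ z, |F z| ≤ K) : Integrable F μ :=
  Integrable.of_bound hm.aestronglyMeasurable K (ae_of_all _ hb)

theorem measurable_finCons {n : ℕ} :
    Measurable (fun p : Z × (Fin n → Z) => (Fin.cons p.1 p.2 : Fin (n + 1) → Z)) := by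
  refine measurable_pi_iff.2 fun i => ?_
  refine Fin.cases ?_ (fun j => ?_) i
  · simpa using measurable_fst
  · simpa [Function.comp_def] using (measurable_pi_apply j).comp measurable_snd

theorem integral_prod_finCons (D : Measure Z) [IsProbabilityMeasure D] {n : ℕ}
    (F : (Fin (n + 1) → Z) → ℝ) :
    ∫ z, F z ∂(Measure.pi fun _ : Fin (n + 1) => D)
      = ∫ u, F (Fin.cons u.1 u.2) ∂(D.prod (Measure.pi fun _ : Fin n => D)) := by
  rw [← ((measurePreserving_piFinSuccAbove (fun _ : Fin (n + 1) => D) 0).symm).integral_comp']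
  refine integral_congr_ae (ae_of_all _ fun u => congrArg F ?_)
  simp [MeasurableEquiv.piFinSuccAbove_symm_apply, Fin.insertNthEquiv]

/-- Integration over `n + 1` coordinates, the first coordinate outermost. -/
theorem integral_finCons (D : Measure Z) [IsProbabilityMeasure D] {n : ℕ}
    {F : (Fin (n + 1) → Z) → ℝ} {K : ℝ} (hm : Measurable F) (hb : ∀ z, |F z| ≤ K) :
    ∫ z, F z ∂(Measure.pi fun _ : Fin (n + 1) => D)
      = ∫ a, ∫ v, F (Fin.cons a v) ∂(Measure.pi fun _ : Fin n => D) ∂D := by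
  rw [integral_prod_finCons, integral_prod]
  exact integrable_of_abs_le (hm.comp measurable_finCons) fun u => hb _

/-- Integration over `n + 1` coordinates, the first coordinate innermost. -/
theorem integral_finCons_symm (D : Measure Z) [IsProbabilityMeasure D] {n : ℕ}
    {F : (Fin (n + 1) → Z) → ℝ} {K : ℝ} (hm : Measurable F) (hb : ∀ z, |F z| ≤ K) :
    ∫ z, F z ∂(Measure.pi fun _ : Fin (n + 1) => D)
      = ∫ v, ∫ a, F (Fin.cons a v) ∂D ∂(Measure.pi fun _ : Fin n => D) := by
  rw [integral_prod_finCons, integral_prod_symm]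
  exact integrable_of_abs_le (hm.comp measurable_finCons) fun u => hb _

theorem abs_integral_le_of_abs_le {Ω : Type*} [MeasurableSpace Ω] {μ : Measure Ω}
    [IsProbabilityMeasure μ] {F : Ω → ℝ} {K : ℝ} (hb : ∀ z, |F z| ≤ K) : |∫ z, F z ∂μ| ≤ K := by
  have := norm_integral_le_of_norm_le_const (μ := μ) (f := F) (C := K) (ae_of_all _ hb)
  simpa using this

theorem measurable_integral_right {Ω : Type*} [MeasurableSpace Ω] {μ : Measure Ω} [SFinite μ]
    {F : Z × Ω → ℝ} (hm : Measurable F) : Measurable fun a => ∫ v, F (a, v) ∂μ :=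
  (hm.stronglyMeasurable.integral_prod_right').measurable

theorem measurable_integral_left {Ω : Type*} [MeasurableSpace Ω] {μ : Measure Z} [SFinite μ]
    {F : Z × Ω → ℝ} (hm : Measurable F) : Measurable fun v => ∫ a, F (a, v) ∂μ :=
  (hm.stronglyMeasurable.integral_prod_left').measurable

/-- Hoeffding's lemma for a function whose oscillation is at most `c`. -/
theorem integral_exp_le_of_osc (D : Measure Z) [IsProbabilityMeasure D] {F : Z → ℝ} {K c : ℝ}
    (hm : Measurable F) (hb : ∀ z, |F z| ≤ K) (hc : ∀ z z', F z - F z' ≤ c) (t : ℝ) :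
    ∫ z, Real.exp (t * F z) ∂D
      ≤ Real.exp (t * ∫ z, F z ∂D + t ^ 2 * c ^ 2 / 8) := by
  have : Nonempty Z := nonempty_of_isProbabilityMeasure D
  have hbdd : BddBelow (Set.range F) := ⟨-K, by rintro _ ⟨z, rfl⟩; exact (abs_le.1 (hb z)).1⟩
  -- Oscillation at most `c` places `F` in an interval of length `c` starting at its infimum, the
  -- form Hoeffding's lemma needs.
  have hmem : ∀ z, F z ∈ Set.Icc (⨅ z, F z) ((⨅ z, F z) + c) := fun z => by
    refine ⟨ciInf_le hbdd z, ?_⟩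
    have : F z - c ≤ ⨅ z, F z := le_ciInf fun z' => by linarith [hc z z']
    linarith
  have h := (ProbabilityTheory.hasSubgaussianMGF_of_mem_Icc (μ := D) hm.aemeasurable
    (ae_of_all _ hmem)).mgf_le t
  have e : (((‖(⨅ z, F z) + c - ⨅ z, F z‖₊ / 2) ^ 2 : NNReal) : ℝ) * t ^ 2 / 2
      = t ^ 2 * c ^ 2 / 8 := by
    simp only [add_sub_cancel_left, NNReal.coe_pow, NNReal.coe_div, coe_nnnorm, Real.norm_eq_abs,
      NNReal.coe_ofNat, div_pow, sq_abs]
    ring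
  rw [e] at h
  simp only [ProbabilityTheory.mgf] at h
  have h2 : ∀ z, Real.exp (t * (F z - ∫ z, F z ∂D))
      = Real.exp (-(t * ∫ z, F z ∂D)) * Real.exp (t * F z) := fun z => by
    rw [← Real.exp_add]; ring_nf
  simp_rw [h2] at h
  rw [integral_const_mul, Real.exp_neg, inv_mul_le_iff₀ (Real.exp_pos _), ← Real.exp_add] at h
  exact h

/-- The moment generating function bound behind McDiarmid's inequality. -/
theorem integral_exp_le_of_boundedDiff (D : Measure Z) [IsProbabilityMeasure D] (t c : ℝ) (n : ℕ) :
    ∀ (F : (Fin n → Z) → ℝ) (K : ℝ), Measurable F → (∀ z, |F z| ≤ K) →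
      (∀ z i a, F (Function.update z i a) - F z ≤ c) →
      ∫ z, Real.exp (t * F z) ∂(Measure.pi fun _ : Fin n => D)
        ≤ Real.exp (t * ∫ z, F z ∂(Measure.pi fun _ : Fin n => D) + n * (t ^ 2 * c ^ 2 / 8)) := by
  induction n with
  | zero =>
    intro F K _ _ _
    simp [integral_unique, Subsingleton.elim _ (default : Fin 0 → Z)]
  | succ n ih =>
    intro F K hm hb hc
    have hexp : ∀ z, |Real.exp (t * F z)| ≤ Real.exp (|t| * K) := fun z => by
      rw [Real.abs_exp]
      refine Real.exp_le_exp.2 ((le_abs_self _).trans ?_)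
      rw [abs_mul]
      exact mul_le_mul_of_nonneg_left (hb z) (abs_nonneg _)
    have hmexp : Measurable fun z => Real.exp (t * F z) := (hm.const_mul t).exp
    rw [integral_finCons D hmexp hexp, integral_finCons D hm hb]
    have hmc : Measurable fun u : Z × (Fin n → Z) => F (Fin.cons u.1 u.2) :=
      hm.comp measurable_finCons
    -- `G` is the conditional mean given the first coordinate. It keeps oscillation `c`, so
    -- Hoeffding's lemma handles `G` while the induction hypothesis handles the remaining
    -- coordinates with the first one frozen.
    set G : Z → ℝ := fun a => ∫ v, F (Fin.cons a v) ∂(Measure.pi fun _ : Fin n => D) with hG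
    have hGm : Measurable G := measurable_integral_right hmc
    have hGb : ∀ a, |G a| ≤ K := fun a => abs_integral_le_of_abs_le fun v => hb _
    have hGc : ∀ a a', G a - G a' ≤ c := fun a a' => by
      have i : ∀ b, Integrable (fun v => F (Fin.cons b v)) (Measure.pi fun _ : Fin n => D) :=
        fun b => integrable_of_abs_le (hmc.comp measurable_prodMk_left) fun v => hb _
      rw [hG]
      simp only
      rw [← integral_sub (i a) (i a')]
      have : ∀ v : Fin n → Z, F (Fin.cons a v) - F (Fin.cons a' v) ≤ c := fun v => by
        have := hc (Fin.cons a' v) 0 a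
        rwa [Fin.update_cons_zero] at this
      refine (integral_mono ((i a).sub (i a')) (integrable_const c) this).trans ?_
      simp
    calc ∫ a, ∫ v, Real.exp (t * F (Fin.cons a v)) ∂(Measure.pi fun _ : Fin n => D) ∂D
        ≤ ∫ a, Real.exp (t * G a) * Real.exp (n * (t ^ 2 * c ^ 2 / 8)) ∂D := by
          refine integral_mono ?_ ?_ fun a => ?_
          · exact integrable_of_abs_le
              (measurable_integral_right (hmexp.comp measurable_finCons))
              fun a => abs_integral_le_of_abs_le fun v => hexp _
          · refine Integrable.mul_const (integrable_of_abs_le (K := Real.exp (|t| * K))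
              (hGm.const_mul t).exp fun a => ?_) _
            rw [Real.abs_exp]
            refine Real.exp_le_exp.2 ((le_abs_self _).trans ?_)
            rw [abs_mul]
            exact mul_le_mul_of_nonneg_left (hGb a) (abs_nonneg _)
          · rw [← Real.exp_add]
            refine ih (fun v => F (Fin.cons a v)) K (hmc.comp measurable_prodMk_left)
              (fun v => hb _) fun v i b => ?_
            have := hc (Fin.cons a v) i.succ b
            rwa [← Fin.cons_update] at this
      _ = (∫ a, Real.exp (t * G a) ∂D) * Real.exp (n * (t ^ 2 * c ^ 2 / 8)) :=
          integral_mul_const _ _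
      _ ≤ Real.exp (t * ∫ a, G a ∂D + t ^ 2 * c ^ 2 / 8) * Real.exp (n * (t ^ 2 * c ^ 2 / 8)) :=
          mul_le_mul_of_nonneg_right (integral_exp_le_of_osc D hGm hGb hGc t) (Real.exp_pos _).le
      _ = _ := by rw [← Real.exp_add]; push_cast; ring_nf

/-- McDiarmid's inequality for bounded differences `1`. -/
theorem measureReal_ge_le_of_boundedDiff (D : Measure Z) [IsProbabilityMeasure D] {n : ℕ}
    (hn : 0 < n) {F : (Fin n → Z) → ℝ} {K : ℝ} (hm : Measurable F) (hb : ∀ z, |F z| ≤ K)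
    (hc : ∀ z i a, F (Function.update z i a) - F z ≤ 1) {t : ℝ} (ht : 0 ≤ t) :
    (Measure.pi fun _ : Fin n => D).real
        {z | (∫ z, F z ∂(Measure.pi fun _ : Fin n => D)) + t ≤ F z}
      ≤ Real.exp (-2 * t ^ 2 / n) := by
  have hn' : (0 : ℝ) < n := by exact_mod_cast hn
  set m := ∫ z, F z ∂(Measure.pi fun _ : Fin n => D)
  -- `4t/n` minimizes the Chernoff exponent `-s t + n s² / 8` over `s`.
  have hs : 0 ≤ 4 * t / n := by positivity
  have hi : Integrable (fun z => Real.exp (4 * t / n * F z)) (Measure.pi fun _ : Fin n => D) := by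
    refine integrable_of_abs_le (K := Real.exp (4 * t / n * K)) (hm.const_mul _).exp fun z => ?_
    rw [Real.abs_exp]
    exact Real.exp_le_exp.2 (mul_le_mul_of_nonneg_left ((le_abs_self _).trans (hb z)) hs)
  refine (ProbabilityTheory.measure_ge_le_exp_mul_mgf (m + t) hs hi).trans ?_
  have h := integral_exp_le_of_boundedDiff D (4 * t / n) 1 n F K hm hb hc
  refine (mul_le_mul_of_nonneg_left h (Real.exp_pos _).le).trans ?_
  rw [← Real.exp_add]
  refine Real.exp_le_exp.2 (le_of_eq ?_)
  change -(4 * t / n) * (m + t) + (4 * t / n * m + _) = _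
  field_simp
  ring

end Concentration

/-! ### Rademacher averages and the maximum of finitely many sign sums. -/

section Rademacher

/-- The average of `F` over all sign vectors of length `n`. -/
noncomputable def signAvg : (n : ℕ) → ((Fin n → ℝ) → ℝ) → ℝ
  | 0, F => F Fin.elim0
  | n + 1, F => (signAvg n (fun s => F (Fin.cons 1 s)) + signAvg n (fun s => F (Fin.cons (-1) s))) / 2

theorem signAvg_mono (n : ℕ) : ∀ {F G : (Fin n → ℝ) → ℝ}, (∀ s, F s ≤ G s) →
    signAvg n F ≤ signAvg n G := by
  induction n with
  | zero => intro F G h; exact h _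
  | succ n ih =>
    intro F G h
    have h1 := ih fun s => h (Fin.cons 1 s)
    have h2 := ih fun s => h (Fin.cons (-1) s)
    simp only [signAvg]
    linarith

theorem signAvg_add (n : ℕ) : ∀ F G : (Fin n → ℝ) → ℝ,
    signAvg n (fun s => F s + G s) = signAvg n F + signAvg n G := by
  induction n with
  | zero => intro F G; rfl
  | succ n ih => intro F G; simp only [signAvg, ih]; ring

theorem signAvg_const_mul (n : ℕ) (c : ℝ) : ∀ F : (Fin n → ℝ) → ℝ,
    signAvg n (fun s => c * F s) = c * signAvg n F := by
  induction n with
  | zero => intro F; rfl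
  | succ n ih => intro F; simp only [signAvg, ih]; ring

theorem signAvg_const (n : ℕ) (c : ℝ) : signAvg n (fun _ => c) = c := by
  induction n with
  | zero => rfl
  | succ n ih => simp [signAvg, ih]

theorem signAvg_sum {ι : Type*} (n : ℕ) (t : Finset ι) (F : ι → (Fin n → ℝ) → ℝ) :
    signAvg n (fun s => ∑ i ∈ t, F i s) = ∑ i ∈ t, signAvg n (F i) := by
  classical
  induction t using Finset.induction_on with
  | empty => simp [signAvg_const]
  | insert a t ha ih => simp only [Finset.sum_insert ha, signAvg_add, ih]

/-- Independent signs are orthogonal, so the cross terms cancel. The offset `b` absorbs the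
coordinate peeled off in the induction. -/
theorem signAvg_sq (n : ℕ) : ∀ (u : Fin n → ℝ) (b : ℝ),
    signAvg n (fun s => (b + ∑ j, s j * u j) ^ 2) = b ^ 2 + ∑ j, u j ^ 2 := by
  induction n with
  | zero => intro u b; simp [signAvg]
  | succ n ih =>
    intro u b
    have e (ε : ℝ) (s : Fin n → ℝ) : b + (ε * u 0 + ∑ j, s j * u (Fin.succ j))
      = (b + ε * u 0) + ∑ j, s j * u (Fin.succ j) := by ring
    simp only [signAvg, Fin.sum_univ_succ, Fin.cons_zero, Fin.cons_succ, e, ih]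
    ring

/-- The average factors over coordinates into `cosh (t u_j)`, and `cosh x ≤ exp (x² / 2)`. -/
theorem signAvg_exp_le (n : ℕ) (t : ℝ) : ∀ (u : Fin n → ℝ) (_ : ∀ j, |u j| ≤ 1),
    signAvg n (fun s => Real.exp (t * ∑ j, s j * u j)) ≤ Real.exp (n * (t ^ 2 / 2)) := by
  induction n with
  | zero => intro u _; simp [signAvg]
  | succ n ih =>
    intro u hu
    have e (ε : ℝ) (s : Fin n → ℝ) : Real.exp (t * (ε * u 0 + ∑ j, s j * u (Fin.succ j)))
      = Real.exp (ε * (t * u 0)) * Real.exp (t * ∑ j, s j * u (Fin.succ j)) := by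
      rw [← Real.exp_add]; ring_nf
    simp only [signAvg, Fin.sum_univ_succ, Fin.cons_zero, Fin.cons_succ, e, signAvg_const_mul]
    have h1 := ih (fun j => u j.succ) fun j => hu _
    have h2 : Real.cosh (t * u 0) ≤ Real.exp (t ^ 2 / 2) := by
      refine (Real.cosh_le_exp_half_sq _).trans (Real.exp_le_exp.2 ?_)
      have : u 0 ^ 2 ≤ 1 := (sq_le_one_iff_abs_le_one _).2 (hu 0)
      have := mul_le_mul_of_nonneg_left this (sq_nonneg t)
      rw [mul_pow]; linarith
    have h3 := mul_le_mul h2 h1 (by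
      rw [← signAvg_const n 0]; exact signAvg_mono n fun s => (Real.exp_pos _).le)
      (Real.exp_pos _).le
    rw [← Real.exp_add, Real.cosh_eq] at h3
    refine le_trans (le_of_eq ?_) (h3.trans (Real.exp_le_exp.2 (le_of_eq ?_)))
    · ring_nf
    · push_cast; ring

/-- The maximum of `N` Rademacher sums has mean at most `√(n m)` as soon as
`N ≤ m` or `2 log (2N) ≤ m`. -/
theorem exists_signAvg_envelope {ι : Type*} [Fintype ι] [Nonempty ι] {n : ℕ} (hn : 0 < n)
    (M : ι → Fin n → ℝ) (hM : ∀ a j, |M a j| ≤ 1) {m : ℝ} (hm : 0 < m)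
    (hN : (Fintype.card ι : ℝ) ≤ m ∨ 2 * Real.log (2 * Fintype.card ι) ≤ m) :
    ∃ U : (Fin n → ℝ) → ℝ, (∀ s a, |∑ j, s j * M a j| ≤ U s) ∧ signAvg n U ≤ √(n * m) := by
  have hn' : (0 : ℝ) < n := by exact_mod_cast hn
  have hr : 0 < √(n * m) := Real.sqrt_pos.2 (by positivity)
  have hr2 : √(n * m) * √(n * m) = n * m := Real.mul_self_sqrt (by positivity)
  set r := √(n * m) with hrdef
  have hN0 : (0 : ℝ) < Fintype.card ι := by exact_mod_cast Fintype.card_pos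
  rcases hN with hN | hN
  -- Few functions: `|x| ≤ x² / (2r) + r / 2`, with the maximum of the squares replaced by their
  -- sum. The averaged sum is at most `n * N ≤ r²`, so both halves contribute at most `r / 2`. An
  -- explicit envelope `U` can be averaged term by term, without Jensen.
  · refine ⟨fun s => (1 / (2 * r)) * (∑ a, (0 + ∑ j, s j * M a j) ^ 2) + r / 2, fun s a => ?_, ?_⟩
    · have h1 : (∑ j, s j * M a j) ^ 2 ≤ ∑ a, (0 + ∑ j, s j * M a j) ^ 2 := by
        refine le_trans (le_of_eq ?_) (Finset.single_le_sum (fun a _ => sq_nonneg _)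
          (Finset.mem_univ a))
        rw [zero_add]
      have h2 : |∑ j, s j * M a j| ≤ (1 / (2 * r)) * (∑ j, s j * M a j) ^ 2 + r / 2 := by
        rw [← sq_abs, ← sub_nonneg]
        set x := |∑ j, s j * M a j|
        have : 1 / (2 * r) * x ^ 2 + r / 2 - x = (x - r) ^ 2 / (2 * r) := by field_simp; ring
        rw [this]; positivity
      refine h2.trans (add_le_add_left (mul_le_mul_of_nonneg_left h1 (by positivity)) _)
    · rw [signAvg_add, signAvg_const_mul, signAvg_sum, signAvg_const]
      simp only [signAvg_sq]
      have h1 : ∑ a, ((0 : ℝ) ^ 2 + ∑ j, M a j ^ 2) ≤ r * r := by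
        rw [hr2]
        calc ∑ a, ((0 : ℝ) ^ 2 + ∑ j, M a j ^ 2) ≤ ∑ a : ι, (n : ℝ) := by
              refine Finset.sum_le_sum fun a _ => ?_
              have : ∑ j, M a j ^ 2 ≤ ∑ j : Fin n, (1 : ℝ) :=
                Finset.sum_le_sum fun j _ => (sq_le_one_iff_abs_le_one _).2 (hM a j)
              simpa using this
          _ = n * Fintype.card ι := by simp [mul_comm]
          _ ≤ n * m := mul_le_mul_of_nonneg_left hN hn'.le
      have h2 := mul_le_mul_of_nonneg_left h1 (by positivity : 0 ≤ 1 / (2 * r))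
      have h3 : 1 / (2 * r) * (r * r) = r / 2 := by field_simp
      linarith
  -- Many functions: `log y ≤ y - 1` at `y = exp (t|x|) / K` gives `t|x| ≤ y + log K - 1 ≤ y + (m -
  -- 1)`. Here `K` bounds the average of the sum of all `exp (± t x_a)`, so the envelope averages to
  -- at most `m / t = r`.
  · set t := r / n with ht
    have htp : 0 < t := by positivity
    have htn : n * (t ^ 2 / 2) = m / 2 := by
      rw [ht, div_pow, sq, hr2]; field_simp
    set K := 2 * Fintype.card ι * Real.exp (n * (t ^ 2 / 2)) with hK
    have hKp : 0 < K := by positivity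
    have hlogK : Real.log K ≤ m := by
      rw [hK, Real.log_mul (by positivity) (Real.exp_pos _).ne', Real.log_exp, htn]; linarith
    refine ⟨fun s => (1 / t) * (((1 / K) * ∑ a, (Real.exp (t * ∑ j, s j * M a j)
      + Real.exp ((-t) * ∑ j, s j * M a j))) + (m - 1)), fun s a => ?_, ?_⟩
    · set x := ∑ j, s j * M a j with hx
      have h1 : Real.exp (t * |x|) ≤ ∑ a, (Real.exp (t * ∑ j, s j * M a j)
          + Real.exp ((-t) * ∑ j, s j * M a j)) := by
        refine le_trans ?_ (Finset.single_le_sum (f := fun a => Real.exp (t * ∑ j, s j * M a j)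
          + Real.exp ((-t) * ∑ j, s j * M a j)) (fun a _ => by positivity) (Finset.mem_univ a))
        simp only [← hx]
        rcases abs_cases x with ⟨h, _⟩ | ⟨h, _⟩ <;> rw [h]
        · linarith [Real.exp_pos (-t * x)]
        · rw [mul_neg, ← neg_mul]; linarith [Real.exp_pos (t * x)]
      have h2 : Real.log (Real.exp (t * |x|) / K) ≤ Real.exp (t * |x|) / K - 1 :=
        Real.log_le_sub_one_of_pos (by positivity)
      rw [Real.log_div (Real.exp_pos _).ne' hKp.ne', Real.log_exp] at h2
      have h3 : Real.exp (t * |x|) / K ≤ (1 / K) * ∑ a, (Real.exp (t * ∑ j, s j * M a j)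
          + Real.exp ((-t) * ∑ j, s j * M a j)) := by
        rw [div_eq_mul_one_div, mul_comm]
        exact mul_le_mul_of_nonneg_left h1 (by positivity)
      have h4 : |x| = (1 / t) * (t * |x|) := by field_simp
      rw [h4]
      exact mul_le_mul_of_nonneg_left (by linarith) (by positivity)
    · rw [signAvg_const_mul, signAvg_add, signAvg_const_mul, signAvg_sum, signAvg_const]
      simp only [signAvg_add]
      have h1 : ∑ a, (signAvg n (fun s => Real.exp (t * ∑ j, s j * M a j))
          + signAvg n (fun s => Real.exp ((-t) * ∑ j, s j * M a j))) ≤ K := by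
        calc _ ≤ ∑ _a : ι, 2 * Real.exp (n * (t ^ 2 / 2)) := by
              refine Finset.sum_le_sum fun a _ => ?_
              have h1 := signAvg_exp_le n t (M a) (hM a)
              have h2 := signAvg_exp_le n (-t) (M a) (hM a)
              rw [neg_sq] at h2
              linarith
          _ = K := by simp [hK]; ring
      have h2 := mul_le_mul_of_nonneg_left h1 (by positivity : 0 ≤ 1 / K)
      rw [one_div_mul_cancel hKp.ne'] at h2
      calc _ ≤ 1 / t * (1 + (m - 1)) := mul_le_mul_of_nonneg_left (by linarith) (by positivity)
        _ = r := by rw [ht]; field_simp; rw [sq, hr2]; ring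

end Rademacher

/-! ### Symmetrization and contraction with an arbitrary offset. -/

section Symmetrization

variable {ι : Type*}

theorem le_iSup_of_finite [Finite ι] (f : ι → ℝ) (i : ι) : f i ≤ ⨆ i, f i :=
  le_ciSup (Set.finite_range f).bddAbove i

theorem abs_iSup_le [Finite ι] [Nonempty ι] {f : ι → ℝ} {K : ℝ} (h : ∀ i, |f i| ≤ K) : |⨆ i, f i| ≤ K := by
  obtain ⟨i⟩ := ‹Nonempty ι›
  have : Nonempty ι := ⟨i⟩
  exact abs_le.2 ⟨(abs_le.1 (h i)).1.trans (le_iSup_of_finite f i),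
    ciSup_le fun i => (abs_le.1 (h i)).2⟩

/-- One-coordinate contraction: replacing increments by larger ones increases the average of the
two suprema. -/
theorem iSup_add_iSup_contraction [Finite ι] [Nonempty ι] (A a b : ι → ℝ) (hab : ∀ i j, |a i - a j| ≤ |b i - b j|) :
    (⨆ i, (A i + a i)) + (⨆ i, (A i - a i)) ≤ (⨆ i, (A i + b i)) + (⨆ i, (A i - b i)) := by
  -- `a i - a j` is at most `|b i - b j|`; the sign of `b i - b j` decides which of `i`, `j` goes
  -- into the supremum with `+ b`.
  have key : ∀ i j, (A i + a i) + (A j - a j) ≤ (⨆ i, (A i + b i)) + (⨆ i, (A i - b i)) := by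
    intro i j
    have h := (le_abs_self _).trans (hab i j)
    have h1 := le_iSup_of_finite (fun i => A i + b i)
    have h2 := le_iSup_of_finite (fun i => A i - b i)
    rcases abs_cases (b i - b j) with ⟨e, _⟩ | ⟨e, _⟩
    · have h3 := h1 i; have h4 := h2 j; linarith
    · have h3 := h1 j; have h4 := h2 i; linarith
  have h1 : ∀ j, (⨆ i, (A i + a i)) ≤ (⨆ i, (A i + b i)) + (⨆ i, (A i - b i)) - (A j - a j) :=
    fun j => ciSup_le fun i => by linarith [key i j]
  have h2 : (⨆ j, (A j - a j)) ≤ (⨆ i, (A i + b i)) + (⨆ i, (A i - b i)) - (⨆ i, (A i + a i)) :=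
    ciSup_le fun j => by linarith [h1 j]
  linarith

variable {Z : Type*}

/-- The symmetrized supremum with offset `A`. -/
noncomputable def symmSup (g : ι → Z → ℝ) (n : ℕ) (A : ι → ℝ) (z : Fin n → Z) : ℝ :=
  signAvg n fun s => ⨆ i, (A i + 2 * ∑ j, s j * g i (z j))

/-- Fixing the first sign moves its term into the offset; this is why the induction runs over all
offsets `A`. -/
theorem symmSup_cons (g : ι → Z → ℝ) (n : ℕ) (A : ι → ℝ) (a : Z) (z : Fin n → Z) :
    symmSup g (n + 1) A (Fin.cons a z)
      = (symmSup g n (fun i => A i + 2 * g i a) z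
          + symmSup g n (fun i => A i + 2 * -g i a) z) / 2 := by
  simp only [symmSup, signAvg, Fin.sum_univ_succ, Fin.cons_zero, Fin.cons_succ, mul_add, one_mul,
    neg_one_mul, add_assoc]

theorem abs_symmSup_le [Finite ι] [Nonempty ι] {g : ι → Z → ℝ} (hg1 : ∀ i z, |g i z| ≤ 1) (n : ℕ) :
    ∀ {A : ι → ℝ} {K : ℝ}, (∀ i, |A i| ≤ K) → ∀ z, |symmSup g n A z| ≤ K + 2 * n := by
  induction n with
  | zero =>
    intro A K hA z
    simpa [symmSup, signAvg] using abs_iSup_le hA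
  | succ n ih =>
    intro A K hA z
    rw [← Fin.cons_self_tail z, symmSup_cons]
    have key : ∀ x : ℝ, |x| ≤ 1 → ∀ y, |y| ≤ K → |y + 2 * x| ≤ K + 2 := fun x hx y hy => by
      refine (abs_add_le _ _).trans ?_
      rw [abs_mul, abs_two]; linarith
    have h1 := ih (A := fun i => A i + 2 * g i (z 0)) (K := K + 2)
      (fun i => key _ (hg1 _ _) _ (hA i)) (Fin.tail z)
    have h2 := ih (A := fun i => A i + 2 * -g i (z 0)) (K := K + 2)
      (fun i => key _ (by rw [abs_neg]; exact hg1 _ _) _ (hA i)) (Fin.tail z)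
    rw [abs_div, abs_two, div_le_iff₀ two_pos]
    refine (abs_add_le _ _).trans ?_
    push_cast
    linarith

variable [MeasurableSpace Z]

theorem measurable_iSup_add [Finite ι] {g : ι → Z → ℝ} (hg : ∀ i, Measurable (g i)) (A : ι → ℝ) :
    Measurable fun z => ⨆ i, (A i + g i z) :=
  Measurable.iSup fun i => (hg i).const_add (A i)

theorem integrable_iSup_add [Finite ι] [Nonempty ι] (D : Measure Z) [IsProbabilityMeasure D] {g : ι → Z → ℝ} {c : ℝ}
    (hg : ∀ i, Measurable (g i)) (hb : ∀ i z, |g i z| ≤ c) (A : ι → ℝ) :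
    Integrable (fun z => ⨆ i, (A i + g i z)) D := by
  obtain ⟨K, hK⟩ := (Set.finite_range fun i => |A i|).bddAbove
  refine integrable_of_abs_le (K := K + c) (measurable_iSup_add hg A) fun z => abs_iSup_le fun i => ?_
  exact (abs_add_le _ _).trans (add_le_add (hK ⟨i, rfl⟩) (hb i z))

/-- Symmetrization and contraction in one coordinate. -/
theorem integral_iSup_sub_le [Finite ι] [Nonempty ι] (D : Measure Z)
    [IsProbabilityMeasure D] {h g : ι → Z → ℝ}
    (hh : ∀ i, Measurable (h i)) (hh1 : ∀ i z, |h i z| ≤ 1)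
    (hg : ∀ i, Measurable (g i)) (hg1 : ∀ i z, |g i z| ≤ 1)
    (hgh : ∀ i j z, |h i z - h j z| ≤ |g i z - g j z|) (A : ι → ℝ) :
    ∫ z, (⨆ i, (A i + ((∫ z, h i z ∂D) - h i z))) ∂D
      ≤ ∫ z, ((⨆ i, (A i + 2 * g i z)) + (⨆ i, (A i + 2 * -g i z))) / 2 ∂D := by
  have bd : ∀ x : ℝ, |x| ≤ 1 → |2 * x| ≤ 2 := fun x hx => by
    rw [abs_mul, abs_two]; linarith
  have ihp : Integrable (fun z => ⨆ i, (A i + 2 * h i z)) D :=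
    integrable_iSup_add D (fun i => (hh i).const_mul 2) (fun i z => bd _ (hh1 i z)) A
  have ihm : Integrable (fun z => ⨆ i, (A i + 2 * -h i z)) D :=
    integrable_iSup_add D (fun i => (hh i).neg.const_mul 2)
      (fun i z => bd _ ((abs_neg _).trans_le (hh1 i z))) A
  have igp : Integrable (fun z => ⨆ i, (A i + 2 * g i z)) D :=
    integrable_iSup_add D (fun i => (hg i).const_mul 2) (fun i z => bd _ (hg1 i z)) A
  have igm : Integrable (fun z => ⨆ i, (A i + 2 * -g i z)) D :=
    integrable_iSup_add D (fun i => (hg i).neg.const_mul 2)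
      (fun i z => bd _ ((abs_neg _).trans_le (hg1 i z))) A
  have hE : ∀ i, |∫ z, h i z ∂D| ≤ 1 := fun i => abs_integral_le_of_abs_le (hh1 i)
  have i0 : Integrable (fun z => ⨆ i, (A i + ((∫ z, h i z ∂D) - h i z))) D :=
    integrable_iSup_add D (c := 2) (fun i => (hh i).const_sub _)
      (fun i z => (abs_sub _ _).trans (by linarith [hE i, hh1 i z])) A
  -- This replaces the ghost sample. Write `A + (E h - h)` as the mean of `A + 2 E h` and `A - 2 h`;
  -- the first is at most `S`, since a supremum of integrals is at most the integral of the
  -- supremum.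
  set S := ∫ z, (⨆ i, (A i + 2 * h i z)) ∂D with hS
  have hS1 : ∀ i, A i + 2 * ∫ z, h i z ∂D ≤ S := fun i => by
    have ih : Integrable (h i) D := integrable_of_abs_le (hh i) (hh1 i)
    have : A i + 2 * ∫ z, h i z ∂D = ∫ z, (A i + 2 * h i z) ∂D := by
      rw [integral_add (integrable_const _) (ih.const_mul 2), integral_const_mul]; simp
    rw [this]
    exact integral_mono ((integrable_const _).add (ih.const_mul 2)) ihp
      fun z => le_iSup_of_finite (fun i => A i + 2 * h i z) i
  calc ∫ z, (⨆ i, (A i + ((∫ z, h i z ∂D) - h i z))) ∂D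
      ≤ ∫ z, (S + ⨆ i, (A i + 2 * -h i z)) / 2 ∂D := by
        refine integral_mono i0 (((integrable_const S).add ihm).div_const 2) fun z => ?_
        refine ciSup_le fun i => ?_
        have h1 := hS1 i
        have h2 := le_iSup_of_finite (fun i => A i + 2 * -h i z) i
        simp only at h2 ⊢
        linarith
    _ = ∫ z, ((⨆ i, (A i + 2 * h i z)) + ⨆ i, (A i + 2 * -h i z)) / 2 ∂D := by
        rw [integral_div, integral_div, integral_add (integrable_const S) ihm,
          integral_add ihp ihm]
        simp [hS]
    _ ≤ _ := by
        refine integral_mono ((ihp.add ihm).div_const 2) ((igp.add igm).div_const 2) fun z => ?_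
        have h1 := iSup_add_iSup_contraction A (fun i => 2 * h i z) (fun i => 2 * g i z)
          fun i j => by
            rw [← mul_sub, ← mul_sub, abs_mul, abs_mul]
            exact mul_le_mul_of_nonneg_left (hgh i j z) (abs_nonneg _)
        simp only [mul_neg, ← sub_eq_add_neg]
        linarith

theorem measurable_signAvg {Ω : Type*} [MeasurableSpace Ω] (n : ℕ) :
    ∀ {F : (Fin n → ℝ) → Ω → ℝ}, (∀ s, Measurable (F s)) →
      Measurable fun z => signAvg n fun s => F s z := by
  induction n with
  | zero => intro F h; exact h _
  | succ n ih =>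
    intro F h
    exact ((ih fun s => h (Fin.cons 1 s)).add (ih fun s => h (Fin.cons (-1) s))).div_const 2

theorem measurable_symmSup [Finite ι] {g : ι → Z → ℝ} (hg : ∀ i, Measurable (g i)) (n : ℕ) {Ω : Type*}
    [MeasurableSpace Ω] {A : ι → Ω → ℝ} (hA : ∀ i, Measurable (A i)) {z : Ω → Fin n → Z}
    (hz : Measurable z) : Measurable fun ω => symmSup g n (fun i => A i ω) (z ω) := by
  refine measurable_signAvg n fun s => Measurable.iSup fun i => (hA i).add ?_
  refine (Finset.measurable_sum _ fun j _ => ?_).const_mul 2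
  exact ((hg i).comp ((measurable_pi_apply j).comp hz)).const_mul (s j)

/-- Symmetrization and contraction for an i.i.d. sample. -/
theorem integral_iSup_sum_sub_le [Finite ι] [Nonempty ι] (D : Measure Z)
    [IsProbabilityMeasure D] {h g : ι → Z → ℝ}
    (hh : ∀ i, Measurable (h i)) (hh1 : ∀ i z, |h i z| ≤ 1)
    (hg : ∀ i, Measurable (g i)) (hg1 : ∀ i z, |g i z| ≤ 1)
    (hgh : ∀ i j z, |h i z - h j z| ≤ |g i z - g j z|) (n : ℕ) : ∀ A : ι → ℝ,
    ∫ z, (⨆ i, (A i + ∑ j, ((∫ z, h i z ∂D) - h i (z j)))) ∂(Measure.pi fun _ : Fin n => D)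
      ≤ ∫ z, symmSup g n A z ∂(Measure.pi fun _ : Fin n => D) := by
  have hE : ∀ i z, |(∫ z, h i z ∂D) - h i z| ≤ 2 := fun i z =>
    (abs_sub _ _).trans (by linarith [abs_integral_le_of_abs_le (μ := D) (hh1 i), hh1 i z])
  have hsum : ∀ (n : ℕ) i (z : Fin n → Z), |∑ j, ((∫ z, h i z ∂D) - h i (z j))| ≤ 2 * n :=
    fun n i z => by
      refine (Finset.abs_sum_le_sum_abs _ _).trans ((Finset.sum_le_sum fun j _ => hE i (z j)).trans ?_)
      simp [mul_comm]
  have hsumm : ∀ (n : ℕ) i, Measurable fun z : Fin n → Z => ∑ j, ((∫ z, h i z ∂D) - h i (z j)) :=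
    fun n i => Finset.measurable_sum _ fun j _ =>
      ((hh i).comp (measurable_pi_apply j)).const_sub _
  induction n with
  | zero =>
    intro A
    simp [symmSup, signAvg]
  | succ n ih =>
    intro A
    obtain ⟨K, hK⟩ := (Set.finite_range fun i => |A i|).bddAbove
    have hK' : ∀ i, |A i| ≤ K := fun i => hK ⟨i, rfl⟩
    have hL1 : Measurable fun z : Fin (n + 1) → Z =>
        ⨆ i, (A i + ∑ j, ((∫ z, h i z ∂D) - h i (z j))) :=
      measurable_iSup_add (hsumm (n + 1)) A
    have hL2 : ∀ z : Fin (n + 1) → Z, |⨆ i, (A i + ∑ j, ((∫ z, h i z ∂D) - h i (z j)))|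
        ≤ K + 2 * (n + 1 : ℕ) := fun z =>
      abs_iSup_le fun i => (abs_add_le _ _).trans (add_le_add (hK' i) (hsum _ i z))
    have key : ∀ x : ℝ, |x| ≤ 1 → ∀ y, |y| ≤ K → |y + 2 * x| ≤ K + 2 := fun x hx y hy => by
      refine (abs_add_le _ _).trans ?_
      rw [abs_mul, abs_two]; linarith
    have b1 : ∀ a i, |A i + 2 * g i a| ≤ K + 2 := fun a i => key _ (hg1 _ _) _ (hK' i)
    have b2 : ∀ a i, |A i + 2 * -g i a| ≤ K + 2 := fun a i =>
      key _ (by rw [abs_neg]; exact hg1 _ _) _ (hK' i)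
    have m1 : ∀ i, Measurable fun a => A i + 2 * g i a := fun i =>
      ((hg i).const_mul 2).const_add _
    have m2 : ∀ i, Measurable fun a => A i + 2 * -g i a := fun i =>
      ((hg i).neg.const_mul 2).const_add _
    -- the suprema over the remaining coordinates, as functions of the pair
    set T : (ι → ℝ) → (Fin n → Z) → ℝ := fun B v =>
      ⨆ i, (B i + ∑ j, ((∫ z, h i z ∂D) - h i (v j))) with hT
    have hTb : ∀ {B : ι → ℝ}, (∀ i, |B i| ≤ K + 2) → ∀ v, |T B v| ≤ K + 2 + 2 * n :=
      fun hB v => abs_iSup_le fun i => (abs_add_le _ _).trans (add_le_add (hB i) (hsum _ i v))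
    have hTm : ∀ {B : ι → Z → ℝ}, (∀ i, Measurable (B i)) →
        Measurable fun u : Z × (Fin n → Z) => T (fun i => B i u.1) u.2 := fun hB =>
      Measurable.iSup fun i => ((hB i).comp measurable_fst).add ((hsumm n i).comp measurable_snd)
    have hPm : Measurable fun u : Z × (Fin n → Z) =>
        (T (fun i => A i + 2 * g i u.1) u.2 + T (fun i => A i + 2 * -g i u.1) u.2) / 2 :=
      ((hTm m1).add (hTm m2)).div_const 2
    have hPb : ∀ a v, |(T (fun i => A i + 2 * g i a) v + T (fun i => A i + 2 * -g i a) v) / 2|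
        ≤ K + 2 + 2 * n := fun a v => by
      rw [abs_div, abs_two, div_le_iff₀ two_pos]
      exact (abs_add_le _ _).trans (by linarith [hTb (b1 a) v, hTb (b2 a) v])
    -- On the left the first coordinate is innermost, so the one-coordinate lemma applies with the
    -- other coordinates as offset. On the right it is outermost, so the induction hypothesis
    -- applies with the offsets `A ± 2 g(a)`. Fubini joins the two.
    rw [integral_finCons_symm D hL1 hL2]
    rw [integral_finCons D (F := symmSup g (n + 1) A) (K := K + 2 * (n + 1 : ℕ))
      (measurable_symmSup hg (n + 1) (fun i => measurable_const) measurable_id)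
      (abs_symmSup_le hg1 (n + 1) hK')]
    calc _ ≤ ∫ v, ∫ a, (T (fun i => A i + 2 * g i a) v + T (fun i => A i + 2 * -g i a) v) / 2 ∂D
            ∂(Measure.pi fun _ : Fin n => D) := by
          refine integral_mono ?_ ?_ fun v => ?_
          · refine integrable_of_abs_le (K := K + 2 * (n + 1 : ℕ)) ?_ fun v =>
              abs_integral_le_of_abs_le fun a => hL2 _
            have hLc := hL1.comp (measurable_finCons (Z := Z) (n := n))
            exact measurable_integral_left hLc
          · refine integrable_of_abs_le (K := K + 2 + 2 * n) ?_ fun v =>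
              abs_integral_le_of_abs_le fun a => hPb a v
            exact measurable_integral_left hPm
          · have h1 := integral_iSup_sub_le D hh hh1 hg hg1 hgh
              (fun i => A i + ∑ j, ((∫ z, h i z ∂D) - h i (v j)))
            refine le_trans (le_of_eq ?_) (h1.trans (le_of_eq ?_))
            · simp only [Fin.sum_univ_succ, Fin.cons_zero, Fin.cons_succ]
              refine integral_congr_ae (ae_of_all _ fun a => iSup_congr fun i => ?_)
              ring
            · refine integral_congr_ae (ae_of_all _ fun a => ?_)
              simp only [hT]
              congr 2 <;> exact iSup_congr fun i => by ring
      _ = ∫ a, ∫ v, (T (fun i => A i + 2 * g i a) v + T (fun i => A i + 2 * -g i a) v) / 2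
            ∂(Measure.pi fun _ : Fin n => D) ∂D := by
          have hPi : Integrable _ (D.prod (Measure.pi fun _ : Fin n => D)) :=
            integrable_of_abs_le hPm fun u => hPb u.1 u.2
          exact (integral_integral_swap hPi).symm
      _ ≤ _ := by
          have iT : ∀ {B : ι → ℝ}, (∀ i, |B i| ≤ K + 2) →
              Integrable (T B) (Measure.pi fun _ : Fin n => D) := fun {B} hB =>
            integrable_of_abs_le (measurable_iSup_add (hsumm n) B) (hTb hB)
          have iS : ∀ {B : ι → ℝ}, (∀ i, |B i| ≤ K + 2) →
              Integrable (symmSup g n B) (Measure.pi fun _ : Fin n => D) := fun {B} hB =>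
            integrable_of_abs_le (measurable_symmSup hg n (fun i => measurable_const) measurable_id)
              (abs_symmSup_le hg1 n hB)
          refine integral_mono ?_ ?_ fun a => ?_
          · exact integrable_of_abs_le (measurable_integral_right hPm) fun a =>
              abs_integral_le_of_abs_le fun v => hPb a v
          · refine integrable_of_abs_le (K := K + 2 * (n + 1 : ℕ)) ?_ fun a =>
              abs_integral_le_of_abs_le fun v => abs_symmSup_le hg1 (n + 1) hK' _
            exact measurable_integral_right (F := fun u : Z × (Fin n → Z) =>
              symmSup g (n + 1) A (Fin.cons u.1 u.2))
              (measurable_symmSup hg (n + 1) (fun i => measurable_const) measurable_finCons)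
          · simp only [symmSup_cons]
            rw [integral_div, integral_div, integral_add (iT (b1 a)) (iT (b2 a)),
              integral_add (iS (b1 a)) (iS (b2 a))]
            have h1 := ih fun i => A i + 2 * g i a
            have h2 := ih fun i => A i + 2 * -g i a
            simp only [hT]
            linarith

/-- The expected uniform deviation of a Lipschitz image of a class whose elements lie in the
absolutely convex hull of finitely many functions. -/
theorem integral_iSup_deviation_le [Finite ι] [Nonempty ι] (D : Measure Z)
    [IsProbabilityMeasure D] {h g : ι → Z → ℝ}
    (hh : ∀ i, Measurable (h i)) (hh1 : ∀ i z, |h i z| ≤ 1)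
    (hg : ∀ i, Measurable (g i)) (hg1 : ∀ i z, |g i z| ≤ 1)
    (hgh : ∀ i j z, |h i z - h j z| ≤ |g i z - g j z|)
    {κ : Type*} [Fintype κ] [Nonempty κ] {M : κ → Z → ℝ} (hM : ∀ a z, |M a z| ≤ 1)
    (hull : ∀ i, ∃ c : κ → ℝ, ∑ a, |c a| ≤ 1 ∧ ∀ z, g i z = ∑ a, c a * M a z)
    {m : ℝ} (hm : 0 < m)
    (hN : (Fintype.card κ : ℝ) ≤ m ∨ 2 * Real.log (2 * Fintype.card κ) ≤ m)
    {n : ℕ} (hn : 0 < n) :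
    ∫ z, (⨆ i, ∑ j, ((∫ z, h i z ∂D) - h i (z j))) ∂(Measure.pi fun _ : Fin n => D)
      ≤ 2 * √(n * m) := by
  have h0 := integral_iSup_sum_sub_le D hh hh1 hg hg1 hgh n (fun _ => 0)
  simp only [zero_add] at h0
  refine h0.trans ?_
  have hz : ∀ z : Fin n → Z, symmSup g n (fun _ => 0) z ≤ 2 * √(n * m) := fun z => by
    obtain ⟨U, hU1, hU2⟩ := exists_signAvg_envelope hn (fun a j => M a (z j))
      (fun a j => hM a _) hm hN
    refine le_trans ?_ (mul_le_mul_of_nonneg_left hU2 zero_le_two)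
    rw [← signAvg_const_mul]
    refine signAvg_mono n fun s => ciSup_le fun i => ?_
    rw [zero_add]
    refine mul_le_mul_of_nonneg_left ?_ zero_le_two
    obtain ⟨c, hc1, hc2⟩ := hull i
    have hU0 : 0 ≤ U s := (abs_nonneg _).trans (hU1 s (Classical.arbitrary κ))
    -- The sign sum is linear in `g`, so over an absolutely convex hull it is controlled by its
    -- values at the generators.
    calc ∑ j, s j * g i (z j) = ∑ a, c a * ∑ j, s j * M a (z j) := by
          simp only [hc2, Finset.mul_sum]
          rw [Finset.sum_comm]
          exact Finset.sum_congr rfl fun a _ => Finset.sum_congr rfl fun j _ => by ring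
      _ ≤ ∑ a, |c a| * U s := Finset.sum_le_sum fun a _ => by
          refine (le_abs_self _).trans ?_
          rw [abs_mul]
          exact mul_le_mul_of_nonneg_left (hU1 s a) (abs_nonneg _)
      _ = (∑ a, |c a|) * U s := by rw [Finset.sum_mul]
      _ ≤ U s := mul_le_of_le_one_left hU0 hc1
  have hi : Integrable (symmSup g n fun _ => 0) (Measure.pi fun _ : Fin n => D) :=
    integrable_of_abs_le (measurable_symmSup hg n (fun i => measurable_const) measurable_id)
      (abs_symmSup_le hg1 n (K := 0) (by simp))
  refine (integral_mono hi (integrable_const _) hz).trans ?_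
  simp

end Symmetrization

/-! ### Bounds on tree functions and their expansion into monomials. -/

section Trees

/-- This is the induction step, at a `+` node, for the bound `3 ^ (m / 3)` on the number of
monomials, cubed to stay in `ℕ`. If both counts are at least `2`, their sum is at most their
product. If one is `1`, then `(1 + N) ^ 3 ≤ 3 N ^ 3` for `N ≥ 3`, and `N = 1, 2` are checked
directly. -/
theorem add_pow_three_le {M N a b : ℕ} (hM : 0 < M) (hN : 0 < N) (ha : 0 < a) (hb : 0 < b)
    (h1 : M ^ 3 ≤ 3 ^ a) (h2 : N ^ 3 ≤ 3 ^ b) : (M + N) ^ 3 ≤ 3 ^ (a + b) := by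
  have one_add : ∀ {N a b : ℕ}, 0 < N → 0 < a → 0 < b → N ^ 3 ≤ 3 ^ b →
      (1 + N) ^ 3 ≤ 3 ^ (a + b) := by
    intro N a b hN ha hb h
    have h3 : 3 ^ (1 + b) ≤ 3 ^ (a + b) := Nat.pow_le_pow_right (by norm_num) (by omega)
    rcases (by omega : N = 1 ∨ N = 2 ∨ 3 ≤ N) with rfl | rfl | hN3
    · have : 3 ^ 2 ≤ 3 ^ (a + b) := Nat.pow_le_pow_right (by norm_num) (by omega)
      omega
    · have hb2 : 2 ≤ b := by
        by_contra hlt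
        obtain rfl : b = 1 := by omega
        norm_num at h
      have : 3 ^ 3 ≤ 3 ^ (a + b) := Nat.pow_le_pow_right (by norm_num) (by omega)
      omega
    · refine le_trans ?_ ((Nat.mul_le_mul_left 3 h).trans (by rw [pow_add, pow_one] at h3; exact h3))
      nlinarith [Nat.mul_le_mul hN3 hN3, Nat.mul_le_mul_left (N * N) hN3, Nat.mul_le_mul_left N hN3]
  rcases (by omega : M = 1 ∨ N = 1 ∨ (2 ≤ M ∧ 2 ≤ N)) with rfl | rfl | ⟨hM2, hN2⟩
  · exact one_add hN ha hb h2
  · rw [add_comm M, add_comm a]; exact one_add hM hb ha h1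
  · have : M + N ≤ M * N := by nlinarith
    calc (M + N) ^ 3 ≤ (M * N) ^ 3 := Nat.pow_le_pow_left this 3
      _ = M ^ 3 * N ^ 3 := mul_pow _ _ _
      _ ≤ 3 ^ a * 3 ^ b := Nat.mul_le_mul h1 h2
      _ = _ := (pow_add _ _ _).symm

/-- Neither alternative covers all `m`: the logarithmic one fails for `N = m = 4`, the linear one
for `N = 6`, `m = 5`. For `m ≤ 4` the hypothesis forces `N ≤ m`; for `m = 5` it forces `N ≤ 6`, and
`12² < e⁵`; for `m ≥ 6`, `(2N)⁶ ≤ 64 · 9 ^ m ≤ 20 ^ m ≤ e ^ (3m)`. -/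
theorem card_le_or_log_le {N m : ℕ} (hN : 0 < N) (hm0 : 0 < m) (h : N ^ 3 ≤ 3 ^ m) :
    (N : ℝ) ≤ m ∨ 2 * Real.log (2 * N) ≤ m := by
  have hN' : (0 : ℝ) < N := by exact_mod_cast hN
  have he : (2.7182 : ℝ) < Real.exp 1 := lt_trans (by norm_num) Real.exp_one_gt_d9
  rcases Nat.lt_or_ge m 5 with hm | hm
  · left
    have : N ≤ m := by
      by_contra hlt
      have h1 : (m + 1) ^ 3 ≤ 3 ^ m := (Nat.pow_le_pow_left (by omega) 3).trans h
      interval_cases m <;> norm_num at h1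
    exact_mod_cast this
  · right
    rcases Nat.eq_or_lt_of_le hm with rfl | hm6
    · have hN6 : N ≤ 6 := by
        by_contra hlt
        have h1 : 7 ^ 3 ≤ 3 ^ 5 := (Nat.pow_le_pow_left (by omega) 3).trans h
        norm_num at h1
      have hN6' : (N : ℝ) ≤ 6 := by exact_mod_cast hN6
      have h1 : 2 * Real.log (2 * N) = Real.log ((2 * N) ^ 2) := by
        rw [Real.log_pow]; norm_num
      rw [h1]
      refine (Real.log_le_iff_le_exp (by positivity)).2 ?_
      have h2 : Real.exp ((5 : ℕ) : ℝ) = Real.exp 1 ^ 5 := by rw [← Real.exp_nat_mul, mul_one]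
      rw [h2]
      have h3 : (2.7182 : ℝ) ^ 5 ≤ Real.exp 1 ^ 5 := pow_le_pow_left₀ (by norm_num) he.le 5
      have h4 : (2 * (N : ℝ)) ^ 2 ≤ 12 ^ 2 := pow_le_pow_left₀ (by positivity) (by linarith) 2
      have h5 : (12 : ℝ) ^ 2 ≤ 2.7182 ^ 5 := by norm_num
      linarith
    · have h1 : 6 * Real.log (2 * N) = Real.log ((2 * N) ^ 6) := by
        rw [Real.log_pow]; norm_num
      have h2 : Real.log ((2 * N) ^ 6) ≤ 3 * m := by
        refine (Real.log_le_iff_le_exp (by positivity)).2 ?_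
        have e1 : Real.exp (3 * m) = (Real.exp 1 ^ 3) ^ m := by
          rw [← Real.exp_nat_mul, ← Real.exp_nat_mul]; push_cast; ring_nf
        have e2 : (20 : ℝ) ≤ Real.exp 1 ^ 3 :=
          le_trans (by norm_num) (pow_le_pow_left₀ (by norm_num : (0 : ℝ) ≤ 2.7182) he.le 3)
        have e3 : (20 : ℝ) ^ m ≤ (Real.exp 1 ^ 3) ^ m := pow_le_pow_left₀ (by norm_num) e2 m
        have e4 : (64 : ℝ) * 9 ^ m ≤ 20 ^ m := by
          obtain ⟨j, rfl⟩ := Nat.exists_eq_add_of_le hm6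
          rw [pow_add, pow_add]
          have : (9 : ℝ) ^ j ≤ 20 ^ j := pow_le_pow_left₀ (by norm_num) (by norm_num) j
          have : (0 : ℝ) < 9 ^ j := by positivity
          norm_num
          nlinarith
        have e5 : (N : ℝ) ^ 3 ≤ 3 ^ m := by exact_mod_cast h
        have e6 : ((N : ℝ) ^ 3) ^ 2 ≤ (3 ^ m) ^ 2 := pow_le_pow_left₀ (by positivity) e5 2
        have e7 : ((3 : ℝ) ^ m) ^ 2 = 9 ^ m := by rw [← pow_mul, mul_comm, pow_mul]; norm_num
        calc (2 * (N : ℝ)) ^ 6 = 64 * (N ^ 3) ^ 2 := by ring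
          _ ≤ 64 * 9 ^ m := by rw [← e7]; linarith
          _ ≤ _ := by rw [e1]; exact e4.trans e3
      linarith

namespace LabeledTree

variable {p q : ℕ}

theorem numLeaves_pos (f : LabeledTree p q) : 0 < f.numLeaves := by
  induction f with
  | leaf i j => exact Nat.one_pos
  | add l r hl hr => simp only [numLeaves]; omega
  | mul l r hl hr => simp only [numLeaves]; omega

theorem numNodes_add_one (f : LabeledTree p q) : f.numNodes + 1 = 2 * f.numLeaves := by
  induction f with
  | leaf i j => rfl
  | add l r hl hr => simp only [numNodes, numLeaves]; omega
  | mul l r hl hr => simp only [numNodes, numLeaves]; omega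

variable {φ : ℕ → ℝ → ℝ}

theorem continuous_eval (φ : ℕ → ℝ → ℝ) (x : Fin p → ℝ) (f : LabeledTree p q) :
    Continuous (f.eval φ x) := by
  induction f with
  | leaf i j => simp only [eval]; fun_prop
  | add l r hl hr =>
    exact (hl.comp (by fun_prop)).add (hr.comp (by fun_prop))
  | mul l r hl hr =>
    exact (hl.comp (by fun_prop)).mul (hr.comp (by fun_prop))

theorem measurable_eval (hφ : ∀ l, Measurable (φ l)) (f : LabeledTree p q) :
    ∀ w, Measurable fun x => f.eval φ x w := by
  induction f with
  | leaf i j =>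
    intro w
    exact ((hφ i).comp (measurable_pi_apply j)).const_mul _
  | add l r hl hr => exact fun w => (hl _).add (hr _)
  | mul l r hl hr => exact fun w => (hl _).mul (hr _)

theorem sum_finAdd {a b : ℕ} (w : Fin (a + b) → ℝ) :
    ∑ i, |w i| = (∑ i, |w (Fin.castAdd b i)|) + ∑ i, |w (Fin.natAdd a i)| :=
  Fin.sum_univ_add _

/-- At a product node with weight norms `A` and `B`, `A * B ≤ A ≤ A + B` because `B ≤ 1`. -/
theorem abs_eval_le (hφ : ∀ l t, φ l t ∈ Set.Icc (-1 : ℝ) 1) (x : Fin p → ℝ)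
    (f : LabeledTree p q) : ∀ w, ∑ a, |w a| ≤ 1 → |f.eval φ x w| ≤ ∑ a, |w a| := by
  induction f with
  | leaf i j =>
    intro w _
    have e : ∑ a, |w a| = |w ⟨0, Nat.one_pos⟩| := Fin.sum_univ_one (fun a : Fin 1 => |w a|)
    rw [e]
    simp only [eval, abs_mul]
    exact mul_le_of_le_one_right (abs_nonneg _) (abs_le.2 (hφ i (x j)))
  | add l r hl hr =>
    intro w hw
    have e := sum_finAdd (a := l.numLeaves) (b := r.numLeaves) w
    have hA := Finset.sum_nonneg fun i (_ : i ∈ Finset.univ) => abs_nonneg (w (Fin.castAdd r.numLeaves i))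
    have hB := Finset.sum_nonneg fun i (_ : i ∈ Finset.univ) => abs_nonneg (w (Fin.natAdd l.numLeaves i))
    change ∑ a : Fin (l.numLeaves + r.numLeaves), |w a| ≤ 1 at hw
    change _ ≤ ∑ a : Fin (l.numLeaves + r.numLeaves), |w a|
    rw [e] at hw ⊢
    exact (abs_add_le _ _).trans (add_le_add (hl _ (by linarith)) (hr _ (by linarith)))
  | mul l r hl hr =>
    intro w hw
    have e := sum_finAdd (a := l.numLeaves) (b := r.numLeaves) w
    have hA := Finset.sum_nonneg fun i (_ : i ∈ Finset.univ) => abs_nonneg (w (Fin.castAdd r.numLeaves i))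
    have hB := Finset.sum_nonneg fun i (_ : i ∈ Finset.univ) => abs_nonneg (w (Fin.natAdd l.numLeaves i))
    change ∑ a : Fin (l.numLeaves + r.numLeaves), |w a| ≤ 1 at hw
    change _ ≤ ∑ a : Fin (l.numLeaves + r.numLeaves), |w a|
    rw [e] at hw ⊢
    have h1 := hl (fun a => w (Fin.castAdd r.numLeaves a)) (by linarith)
    have h2 := hr (fun a => w (Fin.natAdd l.numLeaves a)) (by linarith)
    simp only [eval, abs_mul]
    have h3 := mul_le_mul h1 (h2.trans (by linarith : _ ≤ (1 : ℝ))) (abs_nonneg _) hA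
    linarith

theorem abs_eval_sub_le (hφ : ∀ l t, φ l t ∈ Set.Icc (-1 : ℝ) 1) (x : Fin p → ℝ)
    (f : LabeledTree p q) : ∀ w v, ∑ a, |w a| ≤ 1 → ∑ a, |v a| ≤ 1 →
      |f.eval φ x w - f.eval φ x v| ≤ ∑ a, |w a - v a| := by
  induction f with
  | leaf i j =>
    intro w v _ _
    have e : ∑ a, |w a - v a| = |w ⟨0, Nat.one_pos⟩ - v ⟨0, Nat.one_pos⟩| :=
      Fin.sum_univ_one (fun a : Fin 1 => |w a - v a|)
    rw [e]
    simp only [eval, ← sub_mul, abs_mul]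
    exact mul_le_of_le_one_right (abs_nonneg _) (abs_le.2 (hφ i (x j)))
  | add l r hl hr =>
    intro w v hw hv
    have ew := sum_finAdd (a := l.numLeaves) (b := r.numLeaves) w
    have ev := sum_finAdd (a := l.numLeaves) (b := r.numLeaves) v
    have e := sum_finAdd (a := l.numLeaves) (b := r.numLeaves) (fun a => w a - v a)
    have hA (w : Fin (l.numLeaves + r.numLeaves) → ℝ) := Finset.sum_nonneg
      fun i (_ : i ∈ Finset.univ) => abs_nonneg (w (Fin.castAdd r.numLeaves i))
    have hB (w : Fin (l.numLeaves + r.numLeaves) → ℝ) := Finset.sum_nonneg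
      fun i (_ : i ∈ Finset.univ) => abs_nonneg (w (Fin.natAdd l.numLeaves i))
    change ∑ a : Fin (l.numLeaves + r.numLeaves), |w a| ≤ 1 at hw
    change ∑ a : Fin (l.numLeaves + r.numLeaves), |v a| ≤ 1 at hv
    change _ ≤ ∑ a : Fin (l.numLeaves + r.numLeaves), |w a - v a|
    rw [ew] at hw
    rw [ev] at hv
    rw [e]
    have h1 := hl _ _ (by linarith [hB w] : ∑ i, |w (Fin.castAdd r.numLeaves i)| ≤ 1)
      (by linarith [hB v] : ∑ i, |v (Fin.castAdd r.numLeaves i)| ≤ 1)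
    have h2 := hr _ _ (by linarith [hA w] : ∑ i, |w (Fin.natAdd l.numLeaves i)| ≤ 1)
      (by linarith [hA v] : ∑ i, |v (Fin.natAdd l.numLeaves i)| ≤ 1)
    simp only [eval, add_sub_add_comm]
    exact (abs_add_le _ _).trans (add_le_add h1 h2)
  | mul l r hl hr =>
    intro w v hw hv
    have ew := sum_finAdd (a := l.numLeaves) (b := r.numLeaves) w
    have ev := sum_finAdd (a := l.numLeaves) (b := r.numLeaves) v
    have e := sum_finAdd (a := l.numLeaves) (b := r.numLeaves) (fun a => w a - v a)
    have hA (w : Fin (l.numLeaves + r.numLeaves) → ℝ) := Finset.sum_nonneg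
      fun i (_ : i ∈ Finset.univ) => abs_nonneg (w (Fin.castAdd r.numLeaves i))
    have hB (w : Fin (l.numLeaves + r.numLeaves) → ℝ) := Finset.sum_nonneg
      fun i (_ : i ∈ Finset.univ) => abs_nonneg (w (Fin.natAdd l.numLeaves i))
    change ∑ a : Fin (l.numLeaves + r.numLeaves), |w a| ≤ 1 at hw
    change ∑ a : Fin (l.numLeaves + r.numLeaves), |v a| ≤ 1 at hv
    change _ ≤ ∑ a : Fin (l.numLeaves + r.numLeaves), |w a - v a|
    rw [ew] at hw
    rw [ev] at hv
    rw [e]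
    have wl : ∑ i, |w (Fin.castAdd r.numLeaves i)| ≤ 1 := by linarith [hB w]
    have wr : ∑ i, |w (Fin.natAdd l.numLeaves i)| ≤ 1 := by linarith [hA w]
    have vl : ∑ i, |v (Fin.castAdd r.numLeaves i)| ≤ 1 := by linarith [hB v]
    have vr : ∑ i, |v (Fin.natAdd l.numLeaves i)| ≤ 1 := by linarith [hA v]
    have h1 := hl _ _ wl vl
    have h2 := hr _ _ wr vr
    have h3 := (abs_eval_le hφ x l _ vl).trans vl
    have h4 := (abs_eval_le hφ x r _ wr).trans wr
    simp only [eval]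
    -- In this telescoping of a product, the undifferenced factors are at most `1` in absolute
    -- value.
    rw [show ∀ a b c d : ℝ, a * b - c * d = (a - c) * b + c * (b - d) from fun a b c d => by ring]
    refine (abs_add_le _ _).trans (add_le_add ?_ ?_) <;> rw [abs_mul]
    · exact (mul_le_of_le_one_right (abs_nonneg _) h4).trans h1
    · exact (mul_le_of_le_one_left (abs_nonneg _) h3).trans h2

/-- The expansion of a tree into monomials: `g` lies in the absolutely convex hull of at most
`3 ^ (m / 3)` products of leaves, where `m` is the number of leaves. -/
theorem exists_hull (hφ : ∀ l t, φ l t ∈ Set.Icc (-1 : ℝ) 1) (f : LabeledTree p q) :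
    ∃ (κ : Type) (_ : Fintype κ) (_ : Nonempty κ) (M : κ → (Fin p → ℝ) → ℝ),
      Fintype.card κ ^ 3 ≤ 3 ^ f.numLeaves ∧ (∀ a x, |M a x| ≤ 1) ∧
      ∀ w, ∑ a, |w a| ≤ 1 → ∃ c : κ → ℝ, ∑ a, |c a| ≤ ∑ a, |w a| ∧
        ∀ x, f.eval φ x w = ∑ a, c a * M a x := by
  induction f with
  | leaf i j =>
    refine ⟨Unit, inferInstance, inferInstance, fun _ x => φ i (x j), ?_, ?_, ?_⟩
    · simp [numLeaves]
    · exact fun _ x => abs_le.2 (hφ i (x j))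
    · intro w _
      have e : ∑ a, |w a| = |w ⟨0, Nat.one_pos⟩| := Fin.sum_univ_one (fun a : Fin 1 => |w a|)
      exact ⟨fun _ => w ⟨0, Nat.one_pos⟩, by simp [e], fun x => by simp [eval]⟩
  | add l r hl hr =>
    obtain ⟨κ, _, _, M, h1, h2, h3⟩ := hl
    obtain ⟨κ', _, _, M', h1', h2', h3'⟩ := hr
    refine ⟨κ ⊕ κ', inferInstance, inferInstance, Sum.elim M M', ?_, ?_, ?_⟩
    · rw [Fintype.card_sum]
      change _ ≤ 3 ^ (l.numLeaves + r.numLeaves)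
      exact add_pow_three_le Fintype.card_pos Fintype.card_pos l.numLeaves_pos r.numLeaves_pos h1 h1'
    · rintro (a | a) x
      exacts [h2 a x, h2' a x]
    · intro w hw
      have e := sum_finAdd (a := l.numLeaves) (b := r.numLeaves) w
      have hA := Finset.sum_nonneg
        fun i (_ : i ∈ Finset.univ) => abs_nonneg (w (Fin.castAdd r.numLeaves i))
      have hB := Finset.sum_nonneg
        fun i (_ : i ∈ Finset.univ) => abs_nonneg (w (Fin.natAdd l.numLeaves i))
      change ∑ a : Fin (l.numLeaves + r.numLeaves), |w a| ≤ 1 at hw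
      rw [e] at hw
      obtain ⟨c, hc, hc'⟩ := h3 (fun a => w (Fin.castAdd r.numLeaves a)) (by linarith)
      obtain ⟨c', hd, hd'⟩ := h3' (fun a => w (Fin.natAdd l.numLeaves a)) (by linarith)
      refine ⟨Sum.elim c c', ?_, fun x => ?_⟩
      · change _ ≤ ∑ a : Fin (l.numLeaves + r.numLeaves), |w a|
        rw [e, Fintype.sum_sum_type]
        exact add_le_add hc hd
      · simp only [eval, Fintype.sum_sum_type, Sum.elim_inl, Sum.elim_inr, hc', hd']
  | mul l r hl hr =>
    obtain ⟨κ, _, _, M, h1, h2, h3⟩ := hl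
    obtain ⟨κ', _, _, M', h1', h2', h3'⟩ := hr
    refine ⟨κ × κ', inferInstance, inferInstance, fun a x => M a.1 x * M' a.2 x, ?_, ?_, ?_⟩
    · rw [Fintype.card_prod, mul_pow]
      change _ ≤ 3 ^ (l.numLeaves + r.numLeaves)
      rw [pow_add]
      exact Nat.mul_le_mul h1 h1'
    · rintro a x
      rw [abs_mul]
      exact mul_le_one₀ (h2 _ _) (abs_nonneg _) (h2' _ _)
    · intro w hw
      have e := sum_finAdd (a := l.numLeaves) (b := r.numLeaves) w
      have hA := Finset.sum_nonneg
        fun i (_ : i ∈ Finset.univ) => abs_nonneg (w (Fin.castAdd r.numLeaves i))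
      have hB := Finset.sum_nonneg
        fun i (_ : i ∈ Finset.univ) => abs_nonneg (w (Fin.natAdd l.numLeaves i))
      change ∑ a : Fin (l.numLeaves + r.numLeaves), |w a| ≤ 1 at hw
      rw [e] at hw
      obtain ⟨c, hc, hc'⟩ := h3 (fun a => w (Fin.castAdd r.numLeaves a)) (by linarith)
      obtain ⟨c', hd, hd'⟩ := h3' (fun a => w (Fin.natAdd l.numLeaves a)) (by linarith)
      refine ⟨fun a => c a.1 * c' a.2, ?_, fun x => ?_⟩
      · change _ ≤ ∑ a : Fin (l.numLeaves + r.numLeaves), |w a|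
        rw [e]
        simp only [abs_mul, Fintype.sum_prod_type, ← Finset.mul_sum, ← Finset.sum_mul]
        -- The `ℓ₁` norm of the product coefficients is the product of the norms; one factor is at
        -- most `1`, so the product is at most the sum of the weight norms.
        have h5 := mul_le_mul hc (hd.trans (by linarith : _ ≤ (1 : ℝ)))
          (Finset.sum_nonneg fun _ _ => abs_nonneg _) hA
        linarith
      · simp only [eval, hc', hd', Fintype.sum_prod_type, Finset.sum_mul_sum]
        exact Finset.sum_congr rfl fun a _ => Finset.sum_congr rfl fun b _ => by ring

end LabeledTree

end Trees

/-! ### Counting labeled trees with Catalan numbers. -/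

section Counting

theorem catalan_recurrence (j : ℕ) : (j + 2) * catalan (j + 1) = 2 * (2 * j + 1) * catalan j := by
  have h1 := succ_mul_catalan_eq_centralBinom (j + 1)
  have h2 := succ_mul_catalan_eq_centralBinom j
  have h3 := Nat.succ_mul_centralBinom_succ j
  rw [← h1, ← h2] at h3
  refine Nat.eq_of_mul_eq_mul_left (Nat.succ_pos j) ?_
  calc (j + 1) * ((j + 2) * catalan (j + 1)) = (j + 1) * ((j + 1 + 1) * catalan (j + 1)) := rfl
    _ = _ := h3
    _ = _ := by rw [Nat.succ_eq_add_one]; ring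

/-- The ratio of the two sides stops growing once `4(2j + 1) ≤ (j + 2)(j + 1)`, that is, from `j =
6` on. There `catalan 6 * 2 ^ 6 / 6! = 8448 / 720 < 12`, the largest value. -/
theorem catalan_mul_two_pow_le (j : ℕ) : catalan j * 2 ^ j ≤ 12 * j.factorial := by
  have c0 : catalan 0 = 1 := catalan_zero
  have c1 := catalan_recurrence 0
  have c2 := catalan_recurrence 1
  have c3 := catalan_recurrence 2
  have c4 := catalan_recurrence 3
  have c5 := catalan_recurrence 4
  have c6 := catalan_recurrence 5
  norm_num at c1 c2 c3 c4 c5 c6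
  rcases Nat.lt_or_ge j 6 with hj | hj
  · interval_cases j <;> norm_num [Nat.factorial] <;> omega
  · induction j, hj using Nat.le_induction with
    | base => norm_num [Nat.factorial]; omega
    | succ j hj ih =>
      refine Nat.le_of_mul_le_mul_left ?_ (show 0 < j + 2 by omega)
      calc (j + 2) * (catalan (j + 1) * 2 ^ (j + 1))
          = ((j + 2) * catalan (j + 1)) * 2 ^ (j + 1) := by ring
        _ = (4 * (2 * j + 1)) * (catalan j * 2 ^ j) := by rw [catalan_recurrence]; ring
        _ ≤ ((j + 2) * (j + 1)) * (12 * j.factorial) := Nat.mul_le_mul (by nlinarith) ih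
        _ = (j + 2) * (12 * (j + 1).factorial) := by rw [Nat.factorial_succ]; ring

theorem sum_catalan_mul_two_pow_lt {k : ℕ} (hk : 1 ≤ k) :
    ∑ j ∈ Finset.range (k + 1), catalan j * 2 ^ j < 8 * k * k.factorial := by
  induction k, hk using Nat.le_induction with
  | base => simp [Finset.sum_range_succ]
  | succ k hk ih =>
    rw [Finset.sum_range_succ, Nat.factorial_succ]
    have h := catalan_mul_two_pow_le (k + 1)
    rw [Nat.factorial_succ] at h
    have hf : 0 < k.factorial := k.factorial_pos
    have : 8 * k * k.factorial + 12 * ((k + 1) * k.factorial)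
        ≤ 8 * (k + 1) * ((k + 1) * k.factorial) := by
      have : 8 * k + 12 * (k + 1) ≤ 8 * (k + 1) * (k + 1) := by nlinarith
      have := Nat.mul_le_mul_right k.factorial this
      nlinarith
    omega

variable {p q : ℕ}

/-- A tree with `n + 1` leaves has `n` inner nodes: `catalan n` shapes, two labels per inner node,
`pq` per leaf. Splitting at the root gives the Catalan convolution. -/
theorem exists_finset_numLeaves_eq (n : ℕ) : ∃ s : Finset (LabeledTree p q),
    (∀ f : LabeledTree p q, f.numLeaves = n + 1 → f ∈ s) ∧
      s.card ≤ catalan n * 2 ^ n * (p * q) ^ (n + 1) := by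
  classical
  induction n using Nat.strong_induction_on with
  | _ n ih =>
    cases n with
    | zero =>
      refine ⟨Finset.univ.image fun u : Fin q × Fin p => LabeledTree.leaf u.1 u.2, ?_, ?_⟩
      · rintro (⟨i, j⟩ | ⟨l, r⟩ | ⟨l, r⟩) hf
        · exact Finset.mem_image_of_mem (fun u : Fin q × Fin p => LabeledTree.leaf u.1 u.2)
            (Finset.mem_univ (i, j))
        all_goals
          have := l.numLeaves_pos
          have := r.numLeaves_pos
          simp only [LabeledTree.numLeaves] at hf
          omega
      · refine Finset.card_image_le.trans ?_
        simp [mul_comm]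
    | succ n =>
      have ih' : ∀ m, ∃ s : Finset (LabeledTree p q), m ≤ n →
          (∀ f : LabeledTree p q, f.numLeaves = m + 1 → f ∈ s) ∧
            s.card ≤ catalan m * 2 ^ m * (p * q) ^ (m + 1) := fun m => by
        by_cases hm : m ≤ n
        · obtain ⟨s, hs⟩ := ih m (by omega)
          exact ⟨s, fun _ => hs⟩
        · exact ⟨∅, fun h => absurd h hm⟩
      choose s hs using ih'
      refine ⟨(Finset.HasAntidiagonal.antidiagonal n).biUnion fun ij =>
        ((s ij.1 ×ˢ s ij.2).image fun u => LabeledTree.add u.1 u.2) ∪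
          ((s ij.1 ×ˢ s ij.2).image fun u => LabeledTree.mul u.1 u.2), ?_, ?_⟩
      · rintro (⟨i, j⟩ | ⟨l, r⟩ | ⟨l, r⟩) hf
        · simp [LabeledTree.numLeaves] at hf
        all_goals
          have hl := l.numLeaves_pos
          have hr := r.numLeaves_pos
          simp only [LabeledTree.numLeaves] at hf
          have h1 := (hs (l.numLeaves - 1) (by omega)).1 l (by omega)
          have h2 := (hs (r.numLeaves - 1) (by omega)).1 r (by omega)
          refine Finset.mem_biUnion.2 ⟨(l.numLeaves - 1, r.numLeaves - 1),
            Finset.HasAntidiagonal.mem_antidiagonal.2 (by simp only; omega), ?_⟩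
          rw [Finset.mem_union]
        · exact Or.inl (Finset.mem_image.2 ⟨(l, r), Finset.mem_product.2 ⟨h1, h2⟩, rfl⟩)
        · exact Or.inr (Finset.mem_image.2 ⟨(l, r), Finset.mem_product.2 ⟨h1, h2⟩, rfl⟩)
      · refine Finset.card_biUnion_le.trans ?_
        rw [catalan_succ', Finset.sum_mul, Finset.sum_mul]
        refine Finset.sum_le_sum fun ij hij => ?_
        have hij' := Finset.HasAntidiagonal.mem_antidiagonal.1 hij
        have h1 := (hs ij.1 (by omega)).2
        have h2 := (hs ij.2 (by omega)).2
        have hc : ∀ g : LabeledTree p q × LabeledTree p q → LabeledTree p q,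
            ((s ij.1 ×ˢ s ij.2).image g).card ≤ (s ij.1).card * (s ij.2).card := fun g =>
          Finset.card_image_le.trans (Finset.card_product _ _).le
        refine (Finset.card_union_le _ _).trans ((add_le_add (hc _) (hc _)).trans ?_)
        have h3 := Nat.mul_le_mul h1 h2
        calc _ = 2 * ((s ij.1).card * (s ij.2).card) := by ring
          _ ≤ 2 * _ := Nat.mul_le_mul_left 2 h3
          _ = _ := by rw [← hij']; ring

/-- The number of trees with at most `2k + 1` nodes. -/
theorem exists_finset_eq_trees (hpq : 1 ≤ p * q) (k : ℕ) : ∃ s : Finset (LabeledTree p q),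
    (∀ f, f ∈ s ↔ f ∈ trees p q k) ∧
      s.card ≤ (∑ j ∈ Finset.range (k + 1), catalan j * 2 ^ j) * (p * q) ^ (k + 1) := by
  classical
  choose s hs hc using exists_finset_numLeaves_eq (p := p) (q := q)
  refine ⟨((Finset.range (k + 1)).biUnion s).filter fun f => f ∈ trees p q k, fun f => ?_, ?_⟩
  · rw [Finset.mem_filter, and_iff_right_iff_imp]
    intro hf
    have h1 := f.numNodes_add_one
    have h2 := f.numLeaves_pos
    have h3 : f.numNodes ≤ 2 * k + 1 := hf
    exact Finset.mem_biUnion.2 ⟨f.numLeaves - 1, Finset.mem_range.2 (by omega), hs _ f (by omega)⟩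
  · refine (Finset.card_filter_le _ _).trans (Finset.card_biUnion_le.trans ?_)
    rw [Finset.sum_mul]
    refine Finset.sum_le_sum fun j hj => (hc j).trans ?_
    exact Nat.mul_le_mul_left _ (Nat.pow_le_pow_right hpq
      (by have := Finset.mem_range.1 hj; omega))

end Counting

/-! ### Compactness of the weights and existence of minimizers. -/

section Minimizers

/-- The weight vectors with `‖w‖₁ ≤ 1`. -/
def l1Ball (m : ℕ) : Set (Fin m → ℝ) := {w | ∑ a, |w a| ≤ 1}

theorem isCompact_l1Ball (m : ℕ) : IsCompact (l1Ball m) := by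
  refine Metric.isCompact_of_isClosed_isBounded ?_ ?_
  · exact isClosed_le (by fun_prop) continuous_const
  · refine (Metric.isBounded_closedBall (x := (0 : Fin m → ℝ)) (r := 1)).subset fun w hw => ?_
    rw [mem_closedBall_zero_iff, pi_norm_le_iff_of_nonneg zero_le_one]
    exact fun i => (Finset.single_le_sum (f := fun a => |w a|) (fun a _ => abs_nonneg _)
      (Finset.mem_univ i)).trans hw

theorem zero_mem_l1Ball (m : ℕ) : (0 : Fin m → ℝ) ∈ l1Ball m := by simp [l1Ball]

/-- A finite net makes the suprema over weights finite and hence measurable. Its size never enters a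
bound, so `η` may be as small as needed. -/
theorem exists_finset_l1Net (m : ℕ) {η : ℝ} (hη : 0 < η) : ∃ T : Finset (Fin m → ℝ),
    T.Nonempty ∧ (∀ v ∈ T, v ∈ l1Ball m) ∧ ∀ w ∈ l1Ball m, ∃ v ∈ T, ∑ a, |w a - v a| ≤ η := by
  obtain ⟨t, ht, htf, hcov⟩ := (isCompact_l1Ball m).finite_cover_balls
    (show 0 < η / (m + 1) by positivity)
  have hnet : ∀ w ∈ l1Ball m, ∃ v ∈ htf.toFinset, ∑ a, |w a - v a| ≤ η := fun w hw => by
    obtain ⟨v, hv, hvw⟩ := Set.mem_iUnion₂.1 (hcov hw)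
    refine ⟨v, htf.mem_toFinset.2 hv, ?_⟩
    have h1 : ∀ a, |w a - v a| ≤ η / (m + 1) := fun a => by
      rw [← Real.dist_eq]
      exact (dist_le_pi_dist w v a).trans (Metric.mem_ball.1 hvw).le
    calc ∑ a, |w a - v a| ≤ ∑ _a : Fin m, η / (m + 1) := Finset.sum_le_sum fun a _ => h1 a
      _ = m * (η / (m + 1)) := by simp
      _ ≤ (m + 1) * (η / (m + 1)) := by
          refine mul_le_mul_of_nonneg_right (by linarith) (by positivity)
      _ = η := by field_simp
  refine ⟨htf.toFinset, ?_, fun v hv => ht (htf.mem_toFinset.1 hv), hnet⟩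
  obtain ⟨v, hv, _⟩ := hnet 0 (zero_mem_l1Ball m)
  exact ⟨v, hv⟩

variable {p q k : ℕ} {φ : ℕ → ℝ → ℝ} {Y : Set ℝ} {d : Y → ℝ → ℝ}

/-- The loss of the tree `f` with weights `w`. -/
def treeLoss (φ : ℕ → ℝ → ℝ) (d : Y → ℝ → ℝ) (f : LabeledTree p q) (w : Fin f.numLeaves → ℝ) :
    (Fin p → ℝ) × Y → ℝ :=
  fun z => d z.2 (f.eval φ z.1 w)

theorem mem_hypotheses_iff {h : (Fin p → ℝ) × Y → ℝ} :
    h ∈ hypotheses p q k φ d ↔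
      ∃ f ∈ trees p q k, ∃ w ∈ l1Ball f.numLeaves, h = treeLoss φ d f w := by
  simp only [hypotheses, lossClass, weighted, Set.mem_iUnion, Set.mem_ofPred_eq, exists_prop]
  constructor
  · rintro ⟨f, hf, g, ⟨w, hw, rfl⟩, rfl⟩
    exact ⟨f, hf, w, hw, rfl⟩
  · rintro ⟨f, hf, w, hw, rfl⟩
    exact ⟨f, hf, _, ⟨w, hw, rfl⟩, rfl⟩

/-- Minimize over the compact weight ball for each tree, then over the finitely many trees. -/
theorem exists_isArgmin (hp : 1 ≤ p) (hq : 1 ≤ q) (R : ((Fin p → ℝ) × Y → ℝ) → ℝ)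
    (hR : ∀ f : LabeledTree p q, Continuous fun w => R (treeLoss φ d f w)) :
    ∃ h, IsArgmin (hypotheses p q k φ d) R h := by
  obtain ⟨s, hs, _⟩ := exists_finset_eq_trees (Nat.mul_le_mul hp hq : 1 * 1 ≤ p * q) k
  have hmin : ∀ f : LabeledTree p q, ∃ w ∈ l1Ball f.numLeaves, ∀ v ∈ l1Ball f.numLeaves,
      R (treeLoss φ d f w) ≤ R (treeLoss φ d f v) := fun f =>
    (isCompact_l1Ball _).exists_isMinOn ⟨0, zero_mem_l1Ball _⟩ (hR f).continuousOn
  choose w hw hwmin using hmin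
  have hne : s.Nonempty := ⟨.leaf ⟨0, hq⟩ ⟨0, hp⟩, (hs _).2 (by simp [trees, LabeledTree.numNodes])⟩
  obtain ⟨f, hf, hfmin⟩ := s.exists_min_image (fun f => R (treeLoss φ d f (w f))) hne
  refine ⟨treeLoss φ d f (w f), mem_hypotheses_iff.2 ⟨f, (hs f).1 hf, w f, hw f, rfl⟩, ?_⟩
  intro h hh
  obtain ⟨f', hf', v, hv, rfl⟩ := mem_hypotheses_iff.1 hh
  exact (hfmin f' ((hs f').2 hf')).trans (hwmin f' v hv)

theorem measurable_treeLoss (hφ : ∀ l, Measurable (φ l)) (hd : Measurable (Function.uncurry d))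
    (f : LabeledTree p q) (w : Fin f.numLeaves → ℝ) : Measurable (treeLoss φ d f w) :=
  hd.comp (measurable_snd.prodMk ((f.measurable_eval hφ w).comp measurable_fst))

theorem continuous_treeLoss (hL : ∀ y, LipschitzWith 1 (d y)) (f : LabeledTree p q)
    (z : (Fin p → ℝ) × Y) : Continuous fun w => treeLoss φ d f w z :=
  (hL z.2).continuous.comp (f.continuous_eval φ z.1)

theorem continuous_trueRisk_treeLoss (hφ : ∀ l, Measurable (φ l))
    (hd : Measurable (Function.uncurry d)) (hd1 : ∀ y t, d y t ∈ Set.Icc (0 : ℝ) 1)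
    (hL : ∀ y, LipschitzWith 1 (d y)) (D : Measure ((Fin p → ℝ) × Y)) [IsProbabilityMeasure D]
    (f : LabeledTree p q) : Continuous fun w => trueRisk D (treeLoss φ d f w) := by
  refine continuous_of_dominated (bound := fun _ => 1)
    (fun w => (measurable_treeLoss hφ hd f w).aestronglyMeasurable)
    (fun w => ae_of_all _ fun z => ?_) (integrable_const _)
    (ae_of_all _ fun z => continuous_treeLoss hL f z)
  rw [Real.norm_eq_abs, treeLoss, abs_of_nonneg (hd1 _ _).1]
  exact (hd1 _ _).2

theorem continuous_empiricalRisk_treeLoss (hL : ∀ y, LipschitzWith 1 (d y)) {n : ℕ}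
    (S : Fin n → (Fin p → ℝ) × Y) (f : LabeledTree p q) :
    Continuous fun w => empiricalRisk S (treeLoss φ d f w) :=
  continuous_const.mul (continuous_finsetSum _ fun i _ => continuous_treeLoss hL f (S i))

end Minimizers

/-! ### Uniform deviation for one tree, the union bound and the sample size. -/

section Deviation

variable {Z : Type*}

theorem sum_update_sub {n : ℕ} (ψ : Z → ℝ) (z : Fin n → Z) (i : Fin n) (a : Z) :
    ∑ j, ψ (Function.update z i a j) = ∑ j, ψ (z j) + (ψ a - ψ (z i)) := by
  have h : ∑ j, (ψ (Function.update z i a j) - ψ (z j)) = ψ a - ψ (z i) := by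
    rw [Finset.sum_eq_single i]
    · rw [Function.update_self]
    · intro j _ hj
      rw [Function.update_of_ne hj, sub_self]
    · simp
  rw [Finset.sum_sub_distrib] at h
  linarith

variable [MeasurableSpace Z]

/-- Hoeffding's inequality for the sample sum of a single function. -/
theorem measureReal_sum_ge_le (D : Measure Z) [IsProbabilityMeasure D] {n : ℕ} (hn : 0 < n)
    {h : Z → ℝ} (hm : Measurable h) (h01 : ∀ z, h z ∈ Set.Icc (0 : ℝ) 1) {t : ℝ} (ht : 0 ≤ t) :
    (Measure.pi fun _ : Fin n => D).real {z | n * (∫ z, h z ∂D) + t ≤ ∑ j, h (z j)}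
      ≤ Real.exp (-2 * t ^ 2 / n) := by
  have hb : ∀ z, |h z| ≤ 1 := fun z => abs_le.2 ⟨by linarith [(h01 z).1], (h01 z).2⟩
  have hi : ∀ j : Fin n, Integrable (fun z : Fin n → Z => h (z j)) (Measure.pi fun _ => D) :=
    fun j => integrable_of_abs_le (hm.comp (measurable_pi_apply j)) fun z => hb _
  have hE : ∫ z, ∑ j, h (z j) ∂(Measure.pi fun _ : Fin n => D) = n * ∫ z, h z ∂D := by
    rw [integral_finsetSum _ fun j _ => hi j]
    have : ∀ j : Fin n, ∫ z, h (z j) ∂(Measure.pi fun _ : Fin n => D) = ∫ z, h z ∂D := fun j => by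
      rw [← (measurePreserving_eval (fun _ : Fin n => D) j).map_eq,
        integral_map (measurable_pi_apply j).aemeasurable hm.aestronglyMeasurable,
        (measurePreserving_eval (fun _ : Fin n => D) j).map_eq]
    simp [this]
  rw [← hE]
  refine measureReal_ge_le_of_boundedDiff D hn (K := n) (F := fun z => ∑ j, h (z j))
    (Finset.measurable_sum _ fun j _ => hm.comp (measurable_pi_apply j)) (fun z => ?_)
    (fun z i a => ?_) ht
  · refine (Finset.abs_sum_le_sum_abs _ _).trans ((Finset.sum_le_sum fun j _ => hb (z j)).trans ?_)
    simp
  · rw [sum_update_sub]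
    linarith [(h01 a).2, (h01 (z i)).1]

variable {p q k : ℕ} {φ : ℕ → ℝ → ℝ} {Y : Set ℝ} {d : Y → ℝ → ℝ}

/-- The uniform deviation over all weights of one tree. -/
theorem exists_treeLoss_deviation (hφ : ∀ l, Measurable (φ l))
    (hφ1 : ∀ l t, φ l t ∈ Set.Icc (-1 : ℝ) 1) (hd : Measurable (Function.uncurry d))
    (hd1 : ∀ y t, d y t ∈ Set.Icc (0 : ℝ) 1) (hL : ∀ y, LipschitzWith 1 (d y))
    (D : Measure ((Fin p → ℝ) × Y)) [IsProbabilityMeasure D] {n : ℕ} (hn : 0 < n)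
    (f : LabeledTree p q) {t η : ℝ} (ht : 0 ≤ t) (hη : 0 < η) :
    ∃ B : Set (Fin n → (Fin p → ℝ) × Y), MeasurableSet B ∧
      (Measure.pi fun _ : Fin n => D).real B ≤ Real.exp (-2 * t ^ 2 / n) ∧
      ∀ S ∉ B, ∀ w ∈ l1Ball f.numLeaves,
        n * trueRisk D (treeLoss φ d f w) - ∑ j, treeLoss φ d f w (S j)
          ≤ 2 * √(n * f.numLeaves) + t + 2 * n * η := by
  obtain ⟨T, hT, hT1, hT2⟩ := exists_finset_l1Net f.numLeaves hη
  have : Nonempty T := hT.to_subtype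
  obtain ⟨κ, _, _, M, hκ, hM, hull⟩ := f.exists_hull hφ1
  have hL' : ∀ (y : Y) a b, |d y a - d y b| ≤ |a - b| := fun y a b => by
    simpa [Real.dist_eq] using (hL y).dist_le_mul a b
  have h01 : ∀ w z, treeLoss φ d f w z ∈ Set.Icc (0 : ℝ) 1 := fun w z => hd1 _ _
  have hb : ∀ w z, |treeLoss φ d f w z| ≤ 1 := fun w z =>
    abs_le.2 ⟨by linarith [(h01 w z).1], (h01 w z).2⟩
  have hm := measurable_treeLoss (d := d) hφ hd f
  set F : (Fin n → (Fin p → ℝ) × Y) → ℝ := fun z =>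
    ⨆ v : T, ∑ j, (trueRisk D (treeLoss φ d f v) - treeLoss φ d f v (z j)) with hF
  have hFm : Measurable F := Measurable.iSup fun v => Finset.measurable_sum _ fun j _ =>
    ((hm v).comp (measurable_pi_apply j)).const_sub _
  have hdiff : ∀ w z, |trueRisk D (treeLoss φ d f w) - treeLoss φ d f w z| ≤ 2 := fun w z => by
    have hR : |trueRisk D (treeLoss φ d f w)| ≤ 1 := abs_integral_le_of_abs_le (hb w)
    exact (abs_sub _ _).trans (by linarith [hb w z])
  have hFb : ∀ z, |F z| ≤ n * 2 := fun z => abs_iSup_le fun v => by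
    refine (Finset.abs_sum_le_sum_abs _ _).trans
      ((Finset.sum_le_sum fun j _ => hdiff v (z j)).trans ?_)
    simp
  -- Changing one point changes each sum by a difference of two losses in `[0, 1]`, hence the
  -- difference `1` although the summands are bounded only by `2`.
  have hFc : ∀ z i a, F (Function.update z i a) - F z ≤ 1 := fun z i a => by
    rw [sub_le_iff_le_add]
    refine ciSup_le fun v => ?_
    rw [sum_update_sub (fun x => trueRisk D (treeLoss φ d f v) - treeLoss φ d f v x)]
    have h1 := le_iSup_of_finite
      (fun v : T => ∑ j, (trueRisk D (treeLoss φ d f v) - treeLoss φ d f v (z j))) v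
    have h2 := (h01 v a).1
    have h3 := (h01 v (z i)).2
    simp only [hF]
    linarith
  -- Contraction compares the loss with the tree function through the 1-Lipschitz property.
  have hEF : ∫ z, F z ∂(Measure.pi fun _ : Fin n => D) ≤ 2 * √(n * f.numLeaves) := by
    refine integral_iSup_deviation_le D (h := fun v : T => treeLoss φ d f v)
      (g := fun (v : T) z => f.eval φ z.1 v) (fun v => hm v) (fun v z => hb v z)
      (fun v => (f.measurable_eval hφ v).comp measurable_fst)
      (fun v z => (f.abs_eval_le hφ1 z.1 v (hT1 v v.2)).trans (hT1 v v.2))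
      (fun v v' z => hL' z.2 _ _) (M := fun a z => M a z.1) (fun a z => hM a z.1) (fun v => ?_)
      (by exact_mod_cast f.numLeaves_pos)
      (card_le_or_log_le Fintype.card_pos f.numLeaves_pos hκ) hn
    obtain ⟨c, hc1, hc2⟩ := hull v (hT1 v v.2)
    exact ⟨c, hc1.trans (hT1 v v.2), fun z => hc2 z.1⟩
  refine ⟨{z | (∫ z, F z ∂(Measure.pi fun _ : Fin n => D)) + t ≤ F z},
    measurableSet_le measurable_const hFm,
    measureReal_ge_le_of_boundedDiff D hn hFm hFb hFc ht, fun S hS w hw => ?_⟩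
  obtain ⟨v, hv, hwv⟩ := hT2 w hw
  have hS' : F S < (∫ z, F z ∂(Measure.pi fun _ : Fin n => D)) + t := not_le.1 hS
  have h1 := le_iSup_of_finite
    (fun v : T => ∑ j, (trueRisk D (treeLoss φ d f v) - treeLoss φ d f v (S j))) ⟨v, hv⟩
  have hclose : ∀ z, |treeLoss φ d f w z - treeLoss φ d f v z| ≤ η := fun z =>
    (hL' z.2 _ _).trans ((f.abs_eval_sub_le hφ1 z.1 w v hw (hT1 v hv)).trans hwv)
  have h2 : trueRisk D (treeLoss φ d f w) ≤ trueRisk D (treeLoss φ d f v) + η := by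
    have hi : ∀ w, Integrable (treeLoss φ d f w) D := fun w => integrable_of_abs_le (hm w) (hb w)
    have h3 := abs_integral_le_of_abs_le (μ := D) hclose
    rw [integral_sub (hi w) (hi v)] at h3
    have h4 := (abs_le.1 h3).2
    simp only [trueRisk]
    linarith
  have h5 : ∑ j, treeLoss φ d f v (S j) ≤ ∑ j, treeLoss φ d f w (S j) + n * η := by
    have : ∑ j, treeLoss φ d f v (S j) ≤ ∑ j, (treeLoss φ d f w (S j) + η) :=
      Finset.sum_le_sum fun j _ => by linarith [(abs_le.1 (hclose (S j))).1]
    rw [Finset.sum_add_distrib] at this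
    simpa using this
  have h6 : n * trueRisk D (treeLoss φ d f v) - ∑ j, treeLoss φ d f v (S j) ≤ F S := by
    refine le_trans (le_of_eq ?_) h1
    rw [Finset.sum_sub_distrib]
    simp
  have h7 := mul_le_mul_of_nonneg_left h2 (Nat.cast_nonneg n : (0 : ℝ) ≤ n)
  linarith

/-- Cauchy–Schwarz for three terms; this is the source of the factor `3` in the sample threshold. -/
theorem add_three_lt_of_sq {X s t c : ℝ} (hc : 0 ≤ c)
    (h : 3 * (X ^ 2 + s ^ 2 + t ^ 2) < c ^ 2) : X + s + t < c := by
  refine lt_of_pow_lt_pow_left₀ 2 hc (lt_of_le_of_lt ?_ h)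
  nlinarith [sq_nonneg (X - s), sq_nonneg (X - t), sq_nonneg (s - t)]

/-- The sample size bound gives the excess risk bound with high probability. -/
theorem exists_excessRisk_event {δ ε : ℝ} (hδ : δ ∈ Set.Ioo (0 : ℝ) 1)
    (hε : ε ∈ Set.Ioo (0 : ℝ) 1) {n : ℕ} (hk : 1 ≤ k) (hp : 1 ≤ p) (hq : 1 ≤ q)
    (hφ : ∀ l, Measurable (φ l)) (hφ1 : ∀ l t, φ l t ∈ Set.Icc (-1 : ℝ) 1)
    (hd : Measurable (Function.uncurry d)) (hd1 : ∀ y t, d y t ∈ Set.Icc (0 : ℝ) 1)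
    (hL : ∀ y, LipschitzWith 1 (d y)) (D : Measure ((Fin p → ℝ) × Y)) [IsProbabilityMeasure D]
    (hn : sampleThreshold k p q δ ε ≤ n) {h₀ : (Fin p → ℝ) × Y → ℝ}
    (h₀mem : h₀ ∈ hypotheses p q k φ d) :
    ∃ G : Set (Fin n → (Fin p → ℝ) × Y), MeasurableSet G ∧
      ENNReal.ofReal (1 - δ) ≤ Measure.pi (fun _ : Fin n => D) G ∧
      ∀ S ∈ G, ∀ h, IsArgmin (hypotheses p q k φ d) (empiricalRisk S) h →
        trueRisk D h - trueRisk D h₀ ≤ ε := by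
  obtain ⟨hδ0, hδ1⟩ := hδ
  obtain ⟨hε0, hε1⟩ := hε
  have hpq : 1 ≤ p * q := Nat.mul_le_mul hp hq
  obtain ⟨s, hs, hscard⟩ := exists_finset_eq_trees hpq k
  set c := ∑ j ∈ Finset.range (k + 1), catalan j * 2 ^ j with hc
  have hclt : c < 8 * k * k.factorial := sum_catalan_mul_two_pow_lt hk
  have hc0 : 0 < c := Finset.sum_pos' (fun _ _ => Nat.zero_le _) ⟨0, by simp, by simp⟩
  have hcr : (0 : ℝ) < c := by exact_mod_cast hc0
  have hpqr : (1 : ℝ) ≤ (p : ℝ) * q := by exact_mod_cast hpq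
  have hlpq : 0 ≤ Real.log ((p : ℝ) * q) := Real.log_nonneg hpqr
  -- `exp A` bounds the number of trees, so deviation level `t² = n (A + b) / 2` gives each tree
  -- failure probability at most `exp (-A) * δ / 2`.
  set A := ((k : ℝ) + 1) * Real.log ((p : ℝ) * q) + Real.log c with hA
  have hA0 : 0 ≤ A := add_nonneg (by positivity) (Real.log_nonneg (by exact_mod_cast hc0))
  have hexpA : Real.exp A = c * ((p : ℝ) * q) ^ (k + 1) := by
    rw [hA, Real.exp_add, Real.exp_log hcr]
    have : ((k : ℝ) + 1) * Real.log ((p : ℝ) * q) = ((k + 1 : ℕ) : ℝ) * Real.log ((p : ℝ) * q) := by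
      push_cast; ring
    rw [this, Real.exp_nat_mul, Real.exp_log (by linarith)]
    ring
  have hAlt : A < ((k : ℝ) + 1) * Real.log ((p : ℝ) * q) + Real.log (8 * (k : ℝ) * k.factorial) := by
    have : (c : ℝ) < 8 * (k : ℝ) * k.factorial := by exact_mod_cast hclt
    have := Real.log_lt_log hcr this
    linarith
  set b := Real.log (2 / δ) with hb
  have hb0 : 0 < b := Real.log_pos (by rw [lt_div_iff₀ hδ0]; linarith)
  have hexpb : Real.exp (-b) = δ / 2 := by
    rw [Real.exp_neg, hb, Real.exp_log (by positivity), inv_div]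
  -- The inequality is strict because the tree count lies strictly below `8k · k! · (pq) ^ (k + 1)`.
  -- This slack pays for the net.
  have hbound : 24 * ((k : ℝ) + 1) + 3 * A + 6 * b < 2 * ε ^ 2 * n := by
    rw [sampleThreshold, div_le_iff₀ (by positivity)] at hn
    linarith
  have hn0 : 0 < n := by
    rcases Nat.eq_zero_or_pos n with rfl | h
    · have : (0 : ℝ) ≤ k := Nat.cast_nonneg k
      norm_num at hbound
      linarith
    · exact h
  have hnr : (0 : ℝ) < n := by exact_mod_cast hn0
  have hk0 : (0 : ℝ) < (k : ℝ) + 1 := by positivity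
  have ht2 : √(n * (A + b) / 2) ^ 2 = n * (A + b) / 2 :=
    Real.sq_sqrt (by have : 0 ≤ A + b := by linarith
                     positivity)
  have hs2 : √(n * b / 2) ^ 2 = n * b / 2 := Real.sq_sqrt (by positivity)
  have hX2 : (2 * √(n * ((k : ℝ) + 1))) ^ 2 = 4 * (n * ((k : ℝ) + 1)) := by
    rw [mul_pow, Real.sq_sqrt (by positivity)]; norm_num
  have hsum : 2 * √(n * ((k : ℝ) + 1)) + √(n * (A + b) / 2) + √(n * b / 2) < n * ε := by
    refine add_three_lt_of_sq (by positivity) ?_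
    rw [ht2, hs2, hX2, mul_pow]
    have := mul_lt_mul_of_pos_left hbound (show (0 : ℝ) < n / 2 by positivity)
    linarith
  set X := 2 * √(n * ((k : ℝ) + 1))
  set t := √(n * (A + b) / 2)
  set u := √(n * b / 2)
  -- The net error `2 n η` takes exactly the gap left below `n ε`.
  obtain ⟨η, hη0, hη⟩ : ∃ η : ℝ, 0 < η ∧ X + t + u + 2 * n * η = n * ε :=
    ⟨(n * ε - (X + t + u)) / (2 * n), div_pos (by linarith) (by positivity), by field_simp; ring⟩
  have hdev := fun f : LabeledTree p q => exists_treeLoss_deviation hφ hφ1 hd hd1 hL D hn0 f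
    (t := t) (Real.sqrt_nonneg _) hη0
  choose B hBm hBle hB using hdev
  obtain ⟨f₀, -, w₀, -, rfl⟩ := mem_hypotheses_iff.1 h₀mem
  have hm₀ := measurable_treeLoss (d := d) hφ hd f₀ w₀
  set B₀ : Set (Fin n → (Fin p → ℝ) × Y) :=
    {z | n * (∫ z, treeLoss φ d f₀ w₀ z ∂D) + u ≤ ∑ j, treeLoss φ d f₀ w₀ (z j)} with hB₀
  have hB₀m : MeasurableSet B₀ := measurableSet_le measurable_const
    (Finset.measurable_sum _ fun j _ => hm₀.comp (measurable_pi_apply j))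
  have hBs : MeasurableSet (⋃ f ∈ s, B f) := s.measurableSet_biUnion fun f _ => hBm f
  set P := Measure.pi (fun _ : Fin n => D) with hP
  have hPB₀ : P.real B₀ ≤ δ / 2 := by
    refine (measureReal_sum_ge_le D hn0 hm₀ (fun z => hd1 _ _) (Real.sqrt_nonneg _)).trans ?_
    rw [hs2, ← hexpb]
    refine Real.exp_le_exp.2 (le_of_eq ?_)
    field_simp
  have hPBs : P.real (⋃ f ∈ s, B f) ≤ δ / 2 := by
    have he : Real.exp (-2 * t ^ 2 / n) = Real.exp (-A) * (δ / 2) := by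
      rw [ht2, ← hexpb, ← Real.exp_add]
      congr 1
      field_simp
      ring
    calc P.real (⋃ f ∈ s, B f) ≤ ∑ f ∈ s, P.real (B f) := measureReal_biUnion_finset_le _ _
      _ ≤ ∑ _f ∈ s, Real.exp (-A) * (δ / 2) :=
          Finset.sum_le_sum fun f _ => (hBle f).trans he.le
      _ = s.card * (Real.exp (-A) * (δ / 2)) := by rw [Finset.sum_const, nsmul_eq_mul]
      _ ≤ Real.exp A * (Real.exp (-A) * (δ / 2)) := by
          refine mul_le_mul_of_nonneg_right ?_ (by positivity)
          rw [hexpA]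
          exact_mod_cast hscard
      _ = δ / 2 := by rw [← mul_assoc, ← Real.exp_add, add_neg_cancel, Real.exp_zero, one_mul]
  have hbad : MeasurableSet (B₀ ∪ ⋃ f ∈ s, B f) := hB₀m.union hBs
  refine ⟨(B₀ ∪ ⋃ f ∈ s, B f)ᶜ, hbad.compl, ?_, fun S hS h hh => ?_⟩
  · refine ENNReal.ofReal_le_of_le_toReal ?_
    change _ ≤ P.real _
    rw [probReal_compl_eq_one_sub hbad]
    linarith [measureReal_union_le (μ := P) B₀ (⋃ f ∈ s, B f)]
  · obtain ⟨f, hf, w, hw, rfl⟩ := mem_hypotheses_iff.1 hh.1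
    rw [Set.compl_union, Set.mem_inter_iff, Set.mem_compl_iff, Set.mem_compl_iff] at hS
    have h1 : S ∉ B f := fun hmem => hS.2 (Set.mem_biUnion ((hs f).2 hf) hmem)
    have h2 := hB f S h1 w hw
    have h3 : ∑ j, treeLoss φ d f₀ w₀ (S j) < n * trueRisk D (treeLoss φ d f₀ w₀) + u :=
      not_le.1 hS.1
    have h4 : ∑ j, treeLoss φ d f w (S j) ≤ ∑ j, treeLoss φ d f₀ w₀ (S j) := by
      have := hh.2 _ h₀mem
      simp only [empiricalRisk] at this
      exact le_of_mul_le_mul_left this (by positivity)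
    have h5 : 2 * √(n * f.numLeaves) ≤ X := by
      have h6 := f.numNodes_add_one
      have h7 : f.numNodes ≤ 2 * k + 1 := hf
      have h8 : (f.numLeaves : ℝ) ≤ (k : ℝ) + 1 := by
        have : f.numLeaves ≤ k + 1 := by omega
        exact_mod_cast this
      exact mul_le_mul_of_nonneg_left
        (Real.sqrt_le_sqrt (mul_le_mul_of_nonneg_left h8 hnr.le)) zero_le_two
    refine le_of_mul_le_mul_left (a := (n : ℝ)) ?_ hnr
    linarith

end Deviation

/-- The threshold is `O(k log (pq) + log k!)` for fixed `δ` and `ε`. -/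
theorem exists_sampleThreshold_le {δ ε : ℝ} (hδ : δ ∈ Set.Ioo (0 : ℝ) 1)
    (hε : ε ∈ Set.Ioo (0 : ℝ) 1) :
    ∃ C : ℝ, ∀ k p q : ℕ, 1 ≤ k → 2 ≤ p * q →
      sampleThreshold k p q δ ε
        ≤ C * ((k : ℝ) * Real.log ((p : ℝ) * q) + Real.log (k.factorial : ℝ)) := by
  have hb : 0 ≤ Real.log (2 / δ) :=
    Real.log_nonneg (by rw [le_div_iff₀ hδ.1]; linarith [hδ.2])
  have hl2 : 0 < Real.log 2 := Real.log_pos one_lt_two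
  set b := Real.log (2 / δ)
  have h2ε : 0 < 2 * ε ^ 2 := by have := hε.1; positivity
  -- From `3(k + 1)(l + 8) ≤ 6 k l + 48 k` and `3 log (8k · k!) ≤ 24 k + 3 log k!`, the terms linear
  -- in `k` add up to `72 k`, and `6 b ≤ 6 b k`. Dividing by `log 2 ≤ l` turns `k` into `k l`; this
  -- is where `pq ≥ 2` is needed.
  refine ⟨(6 + (72 + 6 * b) / Real.log 2) / (2 * ε ^ 2), fun k p q hk hpq => ?_⟩
  have hk1 : (1 : ℝ) ≤ k := by exact_mod_cast hk
  have hpq2 : (2 : ℝ) ≤ (p : ℝ) * q := by exact_mod_cast hpq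
  have hl : Real.log 2 ≤ Real.log ((p : ℝ) * q) := Real.log_le_log two_pos hpq2
  set l := Real.log ((p : ℝ) * q)
  have hf1 : (1 : ℝ) ≤ k.factorial := by exact_mod_cast k.factorial_pos
  have hlf : 0 ≤ Real.log (k.factorial : ℝ) := Real.log_nonneg hf1
  have hsplit : Real.log (8 * (k : ℝ) * k.factorial)
      ≤ 8 * k + Real.log (k.factorial : ℝ) := by
    rw [Real.log_mul (by positivity) (by positivity)]
    linarith [Real.log_le_sub_one_of_pos (show (0 : ℝ) < 8 * k by positivity)]
  rw [sampleThreshold, div_mul_eq_mul_div, div_le_div_iff_of_pos_right h2ε]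
  have h1 : (72 + 6 * b) * k ≤ (72 + 6 * b) / Real.log 2 * (k * l) := by
    rw [div_mul_eq_mul_div, le_div_iff₀ hl2, mul_assoc]
    exact mul_le_mul_of_nonneg_left (mul_le_mul_of_nonneg_left hl (by linarith)) (by linarith)
  have h2 : 0 ≤ (72 + 6 * b) / Real.log 2 * Real.log (k.factorial : ℝ) := by positivity
  have h3 : l ≤ k * l := le_mul_of_one_le_left (by linarith) hk1
  have h4 : b ≤ b * k := le_mul_of_one_le_right hb hk1
  nlinarith

end CompTree

theorem corollary1 (δ ε : ℝ) (hδ : δ ∈ Set.Ioo (0 : ℝ) 1) (hε : ε ∈ Set.Ioo (0 : ℝ) 1) :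
    (∀ (k p q n : ℕ) (_ : 1 ≤ k) (_ : 1 ≤ p) (_ : 1 ≤ q)
        (φ : ℕ → ℝ → ℝ) (_ : ∀ l, Measurable (φ l)) (_ : ∀ l t, φ l t ∈ Set.Icc (-1 : ℝ) 1)
        (Y : Set ℝ) (d : Y → ℝ → ℝ) (_ : Measurable (Function.uncurry d))
        (_ : ∀ y t, d y t ∈ Set.Icc (0 : ℝ) 1) (_ : ∀ y, LipschitzWith 1 (d y))
        (D : Measure ((Fin p → ℝ) × Y)) (_ : IsProbabilityMeasure D)
        (_ : CompTree.sampleThreshold k p q δ ε ≤ (n : ℝ)),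
      (∃ hbar, CompTree.IsArgmin (CompTree.hypotheses p q k φ d) (CompTree.trueRisk D) hbar) ∧
      (∀ S : Fin n → (Fin p → ℝ) × Y, ∃ hhat,
        CompTree.IsArgmin (CompTree.hypotheses p q k φ d) (CompTree.empiricalRisk S) hhat) ∧
      ∃ G : Set (Fin n → (Fin p → ℝ) × Y), MeasurableSet G ∧
        ENNReal.ofReal (1 - δ) ≤ Measure.pi (fun _ : Fin n => D) G ∧
        ∀ S ∈ G, ∀ hhat hbar,
          CompTree.IsArgmin (CompTree.hypotheses p q k φ d) (CompTree.empiricalRisk S) hhat →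
          CompTree.IsArgmin (CompTree.hypotheses p q k φ d) (CompTree.trueRisk D) hbar →
          CompTree.trueRisk D hhat - CompTree.trueRisk D hbar ≤ ε) ∧
    (∃ C : ℝ, ∀ k p q : ℕ, 1 ≤ k → 2 ≤ p * q →
      CompTree.sampleThreshold k p q δ ε
        ≤ C * ((k : ℝ) * Real.log ((p : ℝ) * q) + Real.log (k.factorial : ℝ))) := by
  refine ⟨fun k p q n hk hp hq φ hφ hφ1 Y d hd hd1 hL D _ hn => ?_,
    CompTree.exists_sampleThreshold_le hδ hε⟩
  obtain ⟨h₀, hh₀⟩ := CompTree.exists_isArgmin (k := k) hp hq (CompTree.trueRisk D)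
    (CompTree.continuous_trueRisk_treeLoss hφ hd hd1 hL D)
  obtain ⟨G, hGm, hG, hG'⟩ := CompTree.exists_excessRisk_event hδ hε hk hp hq hφ hφ1 hd hd1 hL D hn
    hh₀.1
  refine ⟨⟨h₀, hh₀⟩, fun S => CompTree.exists_isArgmin hp hq _
    (CompTree.continuous_empiricalRisk_treeLoss hL S), G, hGm, hG, fun S hS h h' hh hh' => ?_⟩
  have := hG' S hS h hh
  -- The event was built for the single minimizer `h₀`; it serves every population minimizer because
  -- `h₀` has no larger true risk.
  linarith [hh₀.2 _ hh'.1]
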